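/- Let $\mathfrak g=\mathfrak{sl}(2,\mathbb C)$, let $U$ be its enveloping algebra and $S=S(\mathfrak g)$ its symmetric algebra, i.e. the graded Poisson algebra of polynomial functions on $\mathfrak g^*$, with $\{x,y\}=[x,y]$ for $x,y\in\mathfrak g$. Let $\mathcal O_{\min}\subset\mathfrak g^*$ be the minimal nonzero nilpotent coadjoint orbit, $I\subset S$ the ideal of functions vanishing on $\mathcal O_{\min}$, and $\mathcal R=S/I=\bigoplus_{d\ge 0}\mathcal R^d$ with the induced grading and Poisson bracket (put $\mathcal R^d=0$ for $d<0$). For $x\in\mathfrak g$ let $\mu_x\in\mathcal R^1$ be the image of $x$. A graded star product on $\mathcal R$ is an associative $\mathbb C[t]$-bilinear product $\star$ on $\mathcal R[t]$ such that, writing $f\star g=\sum_{p\ge0}C_p(f,g)t^p$ for $f,g\in\mathcal R$: (i) $C_0(f,g)=fg$; (ii) $C_1(f,g)-C_1(g,f)=\{f,g\}$; (iii) $C_p(f,g)=(-1)^pC_p(g,f)$; (iv) $C_p(f,g)\in\mathcal R^{k+l-p}$ for $f\in\mathcal R^k$, $g\in\mathcal R^l$. It is $G$-equivariant if $\mu_x\star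 f-f\star\mu_x=t\{\mu_x,f\}$ for all $x\in\mathfrak g$, $f\in\mathcal R$. Put $f\circ g=(f\star g)|_{t=1}$. A $G$-equivariant graded star product $\star$ corresponds to the ideal $J$ of $U$ if $J$ is the kernel of the algebra homomorphism $\Psi:U\to(\mathcal R,\circ)$ with $\Psi(x_1\cdots x_d)=\mu_{x_1}\circ\cdots\circ\mu_{x_d}$ for $x_i\in\mathfrak g$. For $\lambda\in\mathbb C$ let $\mathfrak D^\lambda(\mathbb P^1)$ be the algebra of global sections of the sheaf of twisted differential operators acting on local sections of the $\lambda$-th power of the canonical bundle of $\mathbb P^1=\mathbb{CP}^1$, let $\Phi^\lambda:U\to\mathfrak D^\lambda(\mathbb P^1)$ be the algebra homomorphism given by the infinitesimal action of $\mathfrak g$ (in the coordinate $z$ on the big cell, $x=\begin{pmatrix}a&b\\c&-a\end{pmatrix}$ acts on coefficients of $(dz)^\lambda$ by $u\,\tfrac{d}{dz}+\lambda u'$ with $u=-(b+2az-cz^2)$), and let $J^\lambda=\operatorname{Ker}\Phi^\lambda$. Then for every $\lambda\in\mathbb C$ there is exactly one $G$-equivariant graded star product $\star_\lambda$ on $\mathcal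 R$ that corresponds to $J^\lambda$. Every $G$-equivariant graded star product on $\mathcal R$ is equal to $\star_\lambda$ for some $\lambda\in\mathbb C$. For $\lambda,\mu\in\mathbb C$, $\star_\lambda=\star_\mu$ if and only if $\mu=\lambda$ or $\mu=1-\lambda$, i.e. $\mu=\pm(\lambda-\tfrac12)+\tfrac12$. -/

import Mathlib

open scoped Polynomial LaurentPolynomial

noncomputable section

namespace SlTwo

/-- The Lie algebra `𝔤 = 𝔰𝔩(2, ℂ)` of traceless matrices. -/
abbrev g : Type := LieAlgebra.SpecialLinear.sl (Fin 2) ℂ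

/-- The enveloping algebra of `𝔤`. -/
abbrev U : Type := UniversalEnvelopingAlgebra ℂ g

/-- The symmetric algebra of `𝔤`, i.e. the algebra of polynomial functions on `𝔤*`. -/
abbrev S : Type := SymmetricAlgebra ℂ g

/-! ### The Poisson bracket of `S(𝔤)` -/

/-- The algebra homomorphism `a ↦ a + D a ε` from `S(𝔤)` to its dual numbers, where `D` is the
derivation that extends `φ`. -/
def symDerHom (φ : g →ₗ[ℂ] S) : S →ₐ[ℂ] TrivSqZeroExt S S :=
  SymmetricAlgebra.lift
    ((TrivSqZeroExt.inlAlgHom ℂ S S).toLinearMap ∘ₗ SymmetricAlgebra.ι ℂ g +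
      ((TrivSqZeroExt.inrHom S S).restrictScalars ℂ) ∘ₗ φ)

theorem symDerHom_fst (φ : g →ₗ[ℂ] S) (a : S) : (symDerHom φ a).fst = a := by
  have h : (TrivSqZeroExt.fstHom ℂ S S).comp (symDerHom φ) = AlgHom.id ℂ S := by
    apply SymmetricAlgebra.algHom_ext
    ext x
    simp [symDerHom]
  exact DFunLike.congr_fun h a

/-- The derivation of `S(𝔤)` that extends the linear map `φ : 𝔤 → S(𝔤)`. -/
def symDer (φ : g →ₗ[ℂ] S) : Derivation ℂ S S :=
  Derivation.mk' (((TrivSqZeroExt.sndHom S S).restrictScalars ℂ) ∘ₗ (symDerHom φ).toLinearMap)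
    (fun a b => by
      simp [symDerHom_fst, mul_comm])

theorem symDer_ι (φ : g →ₗ[ℂ] S) (x : g) : symDer φ (SymmetricAlgebra.ι ℂ g x) = φ x := by
  simp [symDer, symDerHom]

theorem derivation_ext {D₁ D₂ : Derivation ℂ S S}
    (h : ∀ x, D₁ (SymmetricAlgebra.ι ℂ g x) = D₂ (SymmetricAlgebra.ι ℂ g x)) : D₁ = D₂ := by
  ext a
  induction a using SymmetricAlgebra.induction with
  | algebraMap r => simp
  | ι x => exact h x
  | mul a b ha hb => simp [ha, hb]
  | add a b ha hb => simp [ha, hb]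

/-- For `b` in `S(𝔤)`, the linear map `x ↦ {x, b}` on `𝔤`, where `{x, ·}` is the derivation of
`S(𝔤)` with `{x, y} = [x, y]` for `y` in `𝔤`. -/
def adMap (b : S) : g →ₗ[ℂ] S where
  toFun x := symDer (SymmetricAlgebra.ι ℂ g ∘ₗ (LieAlgebra.ad ℂ g x : g →ₗ[ℂ] g)) b
  map_add' x y := by
    rw [← Derivation.add_apply]
    congr 1
    apply derivation_ext
    intro z
    simp [symDer_ι]
  map_smul' c x := by
    rw [RingHom.id_apply, ← Derivation.smul_apply]
    congr 1
    apply derivation_ext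
    intro z
    simp [symDer_ι]

/-- The Poisson bracket `{a, b}` of `S(𝔤)`: the biderivation with `{x, y} = [x, y]` for `x, y`
in `𝔤`. -/
def poisson (a b : S) : S := symDer (adMap b) a

/-! ### The minimal nilpotent orbit and its coordinate ring -/

/-- The highest root vector of `𝔤`. -/
def e : g := LieAlgebra.SpecialLinear.single 0 1 (by decide) 1

/-- The minimal nilpotent coadjoint orbit in `𝔤*`: the image of the adjoint `SL(2, ℂ)`-orbit of
the highest root vector under the isomorphism of `𝔤` with `𝔤*` given by the Killing form. -/
def Omin : Set (Module.Dual ℂ g) :=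
  {ξ | ∃ (γ : Matrix.SpecialLinearGroup (Fin 2) ℂ) (y : g),
    (y : Matrix (Fin 2) (Fin 2) ℂ) =
      (γ : Matrix (Fin 2) (Fin 2) ℂ) * (e : Matrix (Fin 2) (Fin 2) ℂ) *
        ((γ⁻¹ : Matrix.SpecialLinearGroup (Fin 2) ℂ) : Matrix (Fin 2) (Fin 2) ℂ) ∧
    ξ = killingForm ℂ g y}

/-- The ideal of the polynomial functions on `𝔤*` that vanish on the minimal orbit; the value of
`a` at `ξ` is `SymmetricAlgebra.lift ξ a`. -/
def I : Ideal S where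
  carrier := {a | ∀ ξ ∈ Omin, SymmetricAlgebra.lift ξ a = 0}
  add_mem' ha hb ξ hξ := by rw [map_add, ha ξ hξ, hb ξ hξ, add_zero]
  zero_mem' ξ _ := map_zero _
  smul_mem' c a ha ξ hξ := by rw [smul_eq_mul, map_mul, ha ξ hξ, mul_zero]

/-- The algebra of polynomial functions on the closure of the minimal orbit. -/
def R : Type := S ⧸ I

instance : CommRing R := inferInstanceAs (CommRing (S ⧸ I))

instance : Algebra ℂ R := inferInstanceAs (Algebra ℂ (S ⧸ I))

/-- The projection `S(𝔤) → R`. -/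
def proj : S →ₐ[ℂ] R := Ideal.Quotient.mkₐ ℂ I

/-- The momentum functions `μ_x`. -/
def mom : g →ₗ[ℂ] R := proj.toLinearMap ∘ₗ SymmetricAlgebra.ι ℂ g

/-- The graded piece `R^d`, the image of `S^d(𝔤)`: the span of the `d`-fold products of momentum
functions. It is zero for `d < 0`. -/
def Rgr (d : ℤ) : Submodule ℂ R :=
  if 0 ≤ d then (LinearMap.range mom) ^ d.toNat else ⊥

/-! ### Star products -/

/-- A graded star product on `R`: an associative `ℂ[t]`-bilinear product on `R[t]` such that, with
`f ⋆ h = ∑ C_p(f, h) t^p` for `f, h` in `R`, the four axioms below hold. The Poisson bracket of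
`R` is the one induced by that of `S(𝔤)`, so `{f, h}` is written with representatives. -/
@[ext]
structure StarProduct where
  /-- The product on `R[t]`. -/
  star : R[X] →ₗ[ℂ] R[X] →ₗ[ℂ] R[X]
  X_star : ∀ F G : R[X], star (Polynomial.X * F) G = Polynomial.X * star F G
  star_X : ∀ F G : R[X], star F (Polynomial.X * G) = Polynomial.X * star F G
  assoc : ∀ F G H : R[X], star (star F G) H = star F (star G H)
  /-- `C_0(f, h) = f h` -/
  coeff_zero : ∀ f h : R, (star (Polynomial.C f) (Polynomial.C h)).coeff 0 = f * h
  /-- `C_1(f, h) - C_1(h, f) = {f, h}` -/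
  coeff_one : ∀ a b : S,
    (star (Polynomial.C (proj a)) (Polynomial.C (proj b))).coeff 1 -
      (star (Polynomial.C (proj b)) (Polynomial.C (proj a))).coeff 1 = proj (poisson a b)
  /-- `C_p(f, h) = (-1)^p C_p(h, f)` -/
  parity : ∀ (p : ℕ) (f h : R),
    (star (Polynomial.C f) (Polynomial.C h)).coeff p =
      (-1) ^ p * (star (Polynomial.C h) (Polynomial.C f)).coeff p
  /-- `C_p(R^k, R^l) ⊆ R^(k + l - p)` -/
  graded : ∀ (p k l : ℕ), ∀ f ∈ Rgr k, ∀ h ∈ Rgr l,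
    (star (Polynomial.C f) (Polynomial.C h)).coeff p ∈ Rgr ((k : ℤ) + l - p)

namespace StarProduct

/-- `G`-equivariance (strong `𝔤`-invariance): `μ_x ⋆ f - f ⋆ μ_x = t {μ_x, f}`. -/
def IsEquivariant (s : StarProduct) : Prop :=
  ∀ (x : g) (a : S),
    s.star (Polynomial.C (mom x)) (Polynomial.C (proj a)) -
        s.star (Polynomial.C (proj a)) (Polynomial.C (mom x)) =
      Polynomial.X * Polynomial.C (proj (poisson (SymmetricAlgebra.ι ℂ g x) a))

/-- The product `f ∘ h` on `R`, the value of `f ⋆ h` at `t = 1`. -/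
def circ (s : StarProduct) (f h : R) : R :=
  (s.star (Polynomial.C f) (Polynomial.C h)).eval 1

/-- The star product `s` corresponds to the ideal `J` of `U(𝔤)` if `J` is the kernel of the algebra
homomorphism `Ψ : U(𝔤) → (R, ∘)` with `Ψ x = μ_x` for `x` in `𝔤`, in other words
`Ψ (x₁ ⋯ x_d) = μ_{x₁} ∘ ⋯ ∘ μ_{x_d}`. -/
def CorrespondsTo (s : StarProduct) (J : Ideal U) : Prop :=
  ∃ Ψ : U →ₗ[ℂ] R,
    Ψ 1 = 1 ∧ (∀ u v, Ψ (u * v) = s.circ (Ψ u) (Ψ v)) ∧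
      (∀ x : g, Ψ (UniversalEnvelopingAlgebra.ι ℂ x) = mom x) ∧
      ∀ u, u ∈ J ↔ Ψ u = 0

end StarProduct

/-! ### Twisted differential operators on the projective line

On `ℙ¹` we use the coordinate `z` on the big cell, `w = 1/z` on the other standard chart, and on the
intersection of the charts we identify a local section `f (dz)^l` of the `l`-th power of the
canonical bundle with the Laurent polynomial `f` in `z = T 1`. -/

/-- `d/dz` as a linear map on Laurent polynomials, `z^n ↦ n z^(n-1)`. -/
def ddzLin : ℂ[T;T⁻¹] →ₗ[ℂ] ℂ[T;T⁻¹] :=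
  Finsupp.lsum ℂ
      (fun n : ℤ => LinearMap.toSpanSingleton ℂ ℂ[T;T⁻¹] ((n : ℂ) • LaurentPolynomial.T (n - 1))) ∘ₗ
    (AddMonoidAlgebra.coeffLinearEquiv ℂ).toLinearMap

theorem ddzLin_C_mul_T (n : ℤ) (c : ℂ) :
    ddzLin (LaurentPolynomial.C c * LaurentPolynomial.T n) =
      LaurentPolynomial.C (c * n) * LaurentPolynomial.T (n - 1) := by
  rw [← LaurentPolynomial.single_eq_C_mul_T, map_mul, mul_assoc,
    ← LaurentPolynomial.smul_eq_C_mul, ← LaurentPolynomial.smul_eq_C_mul]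
  change Finsupp.lsum ℂ _ (Finsupp.single n c) = _
  rw [Finsupp.lsum_single, LinearMap.toSpanSingleton_apply]

theorem ddzLin_mul (f h : ℂ[T;T⁻¹]) : ddzLin (f * h) = f • ddzLin h + h • ddzLin f := by
  induction f using LaurentPolynomial.induction_on' with
  | add p q hp hq => simp only [add_mul, map_add, hp, hq, add_smul, smul_add]; abel
  | C_mul_T n a =>
    induction h using LaurentPolynomial.induction_on' with
    | add p q hp hq => simp only [mul_add, map_add, hp, hq, add_smul, smul_add]; abel
    | C_mul_T m b =>
      have h1 : LaurentPolynomial.C a * LaurentPolynomial.T n *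
          (LaurentPolynomial.C b * LaurentPolynomial.T m) =
          LaurentPolynomial.C (a * b) * LaurentPolynomial.T (n + m) := by
        rw [map_mul, LaurentPolynomial.T_add]; ring
      rw [h1, ddzLin_C_mul_T, ddzLin_C_mul_T, ddzLin_C_mul_T]
      simp only [smul_eq_mul, map_mul, Int.cast_add, map_add, LaurentPolynomial.T_add,
        LaurentPolynomial.T_sub]
      ring

/-- The derivation `d/dz` of the algebra of Laurent polynomials. -/
def ddz : Derivation ℂ ℂ[T;T⁻¹] ℂ[T;T⁻¹] := Derivation.mk' ddzLin ddzLin_mul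

theorem ddz_T (n : ℤ) :
    ddz (LaurentPolynomial.T n) = LaurentPolynomial.C (n : ℂ) * LaurentPolynomial.T (n - 1) := by
  have h := ddzLin_C_mul_T n 1
  rw [map_one, one_mul, one_mul] at h
  exact h

/-- Linear operators on the sections over the intersection of the charts. -/
abbrev Op : Type := Module.End ℂ ℂ[T;T⁻¹]

/-- Multiplication by `z^n`. -/
def mulT (n : ℤ) : Op := LinearMap.mulLeft ℂ (LaurentPolynomial.T n)

/-- The operator `d/dw` in the trivialization `(dw)^l`, written in the trivialization `(dz)^l`.
As `(dz)^l = const · w^(-2l) (dw)^l`, it is the conjugate `w^(2l) (d/dw) w^(-2l)`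
`= d/dw - 2l w⁻¹ = -z² d/dz - 2l z`. -/
def ddw (l : ℂ) : Op := -(mulT 2 * (ddz : Op)) - (2 * l) • mulT 1

/-- The twisted differential operators over the chart with coordinate `z`: the algebra generated
by `z` and `d/dz`. -/
def chartZ : Subalgebra ℂ Op := Algebra.adjoin ℂ {mulT 1, (ddz : Op)}

/-- The twisted differential operators over the chart with coordinate `w`: the algebra generated
by `w` and `d/dw`, the latter acting on coefficients of `(dw)^l`. -/
def chartW (l : ℂ) : Subalgebra ℂ Op := Algebra.adjoin ℂ {mulT (-1), ddw l}

/-- The algebra of global sections of the sheaf of twisted differential operators acting on local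
sections of the `l`-th power of the canonical bundle of `ℙ¹`: the operators over the
intersection of the two charts that extend to both charts. -/
def twistedDiffOp (l : ℂ) : Subalgebra ℂ Op := chartZ ⊓ chartW l

/-- The coefficient of the vector field `u d/dz` through which `x` acts on functions on `ℙ¹`: for
`x = (a b; c -a)`, the derivative at `t = 0` of `f(exp(-t x) • z)`, with `•` the action by Möbius
transformations, is `u f'` where `u = -(b + 2 a z - c z²)`. -/
def vf (x : g) : ℂ[T;T⁻¹] :=
  -(LaurentPolynomial.C ((x : Matrix (Fin 2) (Fin 2) ℂ) 0 1) +
    LaurentPolynomial.C (2 * (x : Matrix (Fin 2) (Fin 2) ℂ) 0 0) * LaurentPolynomial.T 1 -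
    LaurentPolynomial.C ((x : Matrix (Fin 2) (Fin 2) ℂ) 1 0) * LaurentPolynomial.T 2)

/-- The twisted vector field of `x`, i.e. the Lie derivative
`f (dz)^l ↦ (u f' + l u' f) (dz)^l` along the vector field `u d/dz` of `x`. -/
def twistedVF (l : ℂ) (x : g) : Op :=
  LinearMap.mulLeft ℂ (vf x) * (ddz : Op) + l • LinearMap.mulLeft ℂ (ddz (vf x))

theorem C_two : (LaurentPolynomial.C 2 : ℂ[T;T⁻¹]) = 2 := map_ofNat _ 2

theorem vf_add (x y : g) : vf (x + y) = vf x + vf y := by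
  have h (i j : Fin 2) : ((x + y : g) : Matrix (Fin 2) (Fin 2) ℂ) i j =
      (x : Matrix (Fin 2) (Fin 2) ℂ) i j + (y : Matrix (Fin 2) (Fin 2) ℂ) i j := rfl
  simp only [vf, h, mul_add, map_add]
  ring

theorem vf_smul (c : ℂ) (x : g) : vf (c • x) = c • vf x := by
  have h (i j : Fin 2) : ((c • x : g) : Matrix (Fin 2) (Fin 2) ℂ) i j =
      c * (x : Matrix (Fin 2) (Fin 2) ℂ) i j := rfl
  simp only [vf, h, map_mul, LaurentPolynomial.smul_eq_C_mul]
  ring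

theorem trace_entry (x : g) :
    (x : Matrix (Fin 2) (Fin 2) ℂ) 1 1 = -(x : Matrix (Fin 2) (Fin 2) ℂ) 0 0 := by
  have h : Matrix.trace (x : Matrix (Fin 2) (Fin 2) ℂ) = 0 :=
    (LinearMap.mem_ker).1 x.2
  rw [Matrix.trace_fin_two] at h
  linear_combination h

theorem ddz_vf (x : g) :
    ddz (vf x) = -(LaurentPolynomial.C (2 * (x : Matrix (Fin 2) (Fin 2) ℂ) 0 0) -
      LaurentPolynomial.C (2 * (x : Matrix (Fin 2) (Fin 2) ℂ) 1 0) * LaurentPolynomial.T 1) := by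
  simp only [vf, LaurentPolynomial.C_eq_algebraMap, map_neg, map_sub, map_add,
    Derivation.leibniz, Derivation.map_algebraMap, ddz_T, smul_eq_mul]
  norm_num
  ring

theorem vf_lie (x y : g) : vf ⁅x, y⁆ = vf x * ddz (vf y) - vf y * ddz (vf x) := by
  have hT : (LaurentPolynomial.T 2 : ℂ[T;T⁻¹]) =
      LaurentPolynomial.T 1 * LaurentPolynomial.T 1 := by
    rw [← LaurentPolynomial.T_add]; norm_num
  rw [ddz_vf, ddz_vf]
  simp only [vf, LieAlgebra.SpecialLinear.sl_bracket, Matrix.sub_apply, Matrix.mul_apply,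
    Fin.sum_univ_two, trace_entry, map_mul, map_sub, map_add, map_neg, hT, C_two]
  ring

theorem twistedVF_mem (l : ℂ) (x : g) : twistedVF l x ∈ twistedDiffOp l := by
  have h0 : twistedVF l x =
      -((x : Matrix (Fin 2) (Fin 2) ℂ) 0 1 • (ddz : Op)
        + (2 * (x : Matrix (Fin 2) (Fin 2) ℂ) 0 0) • (mulT 1 * (ddz : Op))
        - (x : Matrix (Fin 2) (Fin 2) ℂ) 1 0 • (mulT 1 * (mulT 1 * (ddz : Op)))
        + (2 * l * (x : Matrix (Fin 2) (Fin 2) ℂ) 0 0) • 1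
        - (2 * l * (x : Matrix (Fin 2) (Fin 2) ℂ) 1 0) • mulT 1) := by
    have hT : (LaurentPolynomial.T 2 : ℂ[T;T⁻¹]) =
        LaurentPolynomial.T 1 * LaurentPolynomial.T 1 := by
      rw [← LaurentPolynomial.T_add]; norm_num
    apply LinearMap.ext
    intro f
    rw [twistedVF, ddz_vf]
    simp only [mulT, vf, LinearMap.add_apply, LinearMap.sub_apply,
      LinearMap.neg_apply, LinearMap.smul_apply, Module.End.mul_apply, LinearMap.mulLeft_apply,
      Module.End.one_apply, LaurentPolynomial.smul_eq_C_mul, map_mul, hT]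
    ring
  have h1 : twistedVF l x =
      (x : Matrix (Fin 2) (Fin 2) ℂ) 0 1 •
          (mulT (-1) * (mulT (-1) * ddw l) + (2 * l) • mulT (-1))
        + (x : Matrix (Fin 2) (Fin 2) ℂ) 0 0 • ((2 : ℂ) • (mulT (-1) * ddw l) + (2 * l) • 1)
        - (x : Matrix (Fin 2) (Fin 2) ℂ) 1 0 • ddw l := by
    have hT : (LaurentPolynomial.T 2 : ℂ[T;T⁻¹]) =
        LaurentPolynomial.T 1 * LaurentPolynomial.T 1 := by
      rw [← LaurentPolynomial.T_add]; norm_num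
    have hT' : (LaurentPolynomial.T 1 : ℂ[T;T⁻¹]) * LaurentPolynomial.T (-1) = 1 := by
      rw [← LaurentPolynomial.T_add]; norm_num
    apply LinearMap.ext
    intro f
    rw [twistedVF, ddz_vf]
    simp only [mulT, ddw, vf, LinearMap.add_apply, LinearMap.sub_apply,
      LinearMap.neg_apply, LinearMap.smul_apply, Module.End.mul_apply, LinearMap.mulLeft_apply,
      Module.End.one_apply, LaurentPolynomial.smul_eq_C_mul, map_mul, hT, map_ofNat]
    linear_combination
      (2 * LaurentPolynomial.C ((x : Matrix (Fin 2) (Fin 2) ℂ) 0 1) * LaurentPolynomial.C l * f *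
          LaurentPolynomial.T (-1) +
        LaurentPolynomial.C ((x : Matrix (Fin 2) (Fin 2) ℂ) 0 1) * (ddz : Op) f *
          (LaurentPolynomial.T 1 * LaurentPolynomial.T (-1) + 1) +
        2 * LaurentPolynomial.C ((x : Matrix (Fin 2) (Fin 2) ℂ) 0 0) * LaurentPolynomial.T 1 *
          (ddz : Op) f +
        4 * LaurentPolynomial.C ((x : Matrix (Fin 2) (Fin 2) ℂ) 0 0) * LaurentPolynomial.C l * f) *
      hT'
  rw [twistedDiffOp, Algebra.mem_inf]
  have hz : mulT 1 ∈ chartZ := Algebra.subset_adjoin (by simp)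
  have hdz : (ddz : Op) ∈ chartZ := Algebra.subset_adjoin (by simp)
  have hw : mulT (-1) ∈ chartW l := Algebra.subset_adjoin (by simp)
  have hdw : ddw l ∈ chartW l := Algebra.subset_adjoin (by simp)
  constructor
  · rw [h0]
    exact neg_mem (sub_mem (add_mem (sub_mem (add_mem (Subalgebra.smul_mem _ hdz _)
      (Subalgebra.smul_mem _ (mul_mem hz hdz) _))
      (Subalgebra.smul_mem _ (mul_mem hz (mul_mem hz hdz)) _))
      (Subalgebra.smul_mem _ (one_mem _) _)) (Subalgebra.smul_mem _ hz _))
  · rw [h1]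
    exact sub_mem (add_mem (Subalgebra.smul_mem _ (add_mem (mul_mem hw (mul_mem hw hdw))
      (Subalgebra.smul_mem _ hw _)) _) (Subalgebra.smul_mem _ (add_mem
      (Subalgebra.smul_mem _ (mul_mem hw hdw) _) (Subalgebra.smul_mem _ (one_mem _) _)) _))
      (Subalgebra.smul_mem _ hdw _)

theorem twistedVF_lie (l : ℂ) (x y : g) :
    twistedVF l ⁅x, y⁆ = twistedVF l x * twistedVF l y - twistedVF l y * twistedVF l x := by
  apply LinearMap.ext
  intro f
  simp only [twistedVF, vf_lie, LinearMap.add_apply, LinearMap.sub_apply, LinearMap.smul_apply,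
    Module.End.mul_apply, LinearMap.mulLeft_apply, LaurentPolynomial.smul_eq_C_mul,
    Derivation.coeFn_coe, map_sub, map_add, Derivation.leibniz, smul_eq_mul,
    LaurentPolynomial.C_eq_algebraMap, Derivation.map_algebraMap]
  ring

attribute [local instance] LieRing.ofAssociativeRing LieAlgebra.ofAssociativeAlgebra

/-- The Lie algebra homomorphism `x ↦ Φ^l_x`, the infinitesimal action of `𝔤` on local sections of
the `l`-th power of the canonical bundle. -/
def phiLie (l : ℂ) : g →ₗ⁅ℂ⁆ twistedDiffOp l where
  toFun x := ⟨twistedVF l x, twistedVF_mem l x⟩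
  map_add' x y := by
    apply Subtype.ext
    apply LinearMap.ext
    intro f
    simp [twistedVF, vf_add, add_mul]
    ring
  map_smul' c x := by
    apply Subtype.ext
    apply LinearMap.ext
    intro f
    have h : ddz (LaurentPolynomial.C c * vf x) = LaurentPolynomial.C c * ddz (vf x) := by
      rw [← LaurentPolynomial.smul_eq_C_mul, ← LaurentPolynomial.smul_eq_C_mul]
      exact ddz.map_smul c (vf x)
    simp only [twistedVF, vf_smul, LinearMap.add_apply, LinearMap.smul_apply,
      Module.End.mul_apply, LinearMap.mulLeft_apply, RingHom.id_apply, SetLike.val_smul,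
      LaurentPolynomial.smul_eq_C_mul, h]
    ring
  map_lie' {x y} := by
    apply Subtype.ext
    exact twistedVF_lie l x y

/-- The algebra homomorphism `Φ^l` from `U(𝔤)` to the algebra of global twisted differential
operators on `ℙ¹`. -/
def Phi (l : ℂ) : U →ₐ[ℂ] twistedDiffOp l := UniversalEnvelopingAlgebra.lift ℂ (phiLie l)

/-- The two-sided ideal `J^l = Ker Φ^l` of `U(𝔤)`. -/
def J (l : ℂ) : Ideal U := RingHom.ker (Phi l)

end SlTwo

end

open scoped Polynomial LaurentPolynomial

noncomputable section

namespace SlTwo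

attribute [local instance] LieRing.ofAssociativeRing LieAlgebra.ofAssociativeAlgebra

/-! ### Coordinates on `𝔤` -/

/-! The orbit closure is the plane modulo sign. Pulling functions back along `orbitPoint` embeds `R`
in `ℂ[u, v]` as the polynomials with monomials of even degree only; `R^d` becomes the forms of
degree `2d`, and the Poisson bracket becomes `-1/2` times the canonical bracket of the plane
(`mem_I_iff`, `mem_Rgr_iff`, `rhoS_poisson`).

Existence. Left multiplication by `μ_x` is taken to be `μ_x + (t/2){μ_x, ·} + t² Λ_x`, and right
multiplication is the same with `-t` for `t`. Here `Λ_x` is an invariant second order operator with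
constant coefficients, rescaled in each degree. Left and right multiplications commute exactly
because the scaling factors solve a first order recursion (`quad_diffTwo`, `coef_rec`), whose free
constant is `τ`. Both generated algebras reach all of `R[t]` from `1`, and they commute, so a left
operator is determined by its value at `1` (`evalOne_bijective`). Composition of left operators is
then the associative product sought, and `t ↦ -t` exchanges the two sides and gives the parity
axiom.

Uniqueness. For any equivariant star product the Casimir element `h² - 2h + 4ef` goes to a scalar
`c` (`exists_casimir_eq`). Modulo `Casimir - c`, `U` is spanned by the words `eⁱ hⁿ fʲ` with `n ≤
1`, and these have distinct leading monomials in `ℂ[u, v]`, so `c` determines the kernel of `psi : U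
→ R`. Since `psi` is equivariant and takes `e^k` to `μ_e^k`, `c` determines `psi` too, hence the
product `∘`, and by homogeneity `⋆` (`StarProduct.eq_of_casimir_eq`).

Comparison with `J^l`. The map `Phi l` takes the Casimir element to `4l(l - 1)`. If this equals `c`,
then `ker psi ⊆ ker (Phi l)` by the spanning argument. Conversely, `psi (ker (Phi l))` is stable
under `e`, which acts locally nilpotently; if nonzero, it would contain a nonzero polynomial in
`μ_e`, and a nonzero polynomial in `d/dz` would vanish. So `⋆_l` is the product with `c = 4l(l -
1)`; this value takes every complex number, and agrees at `l` and `m` exactly when `m = l` or `m = 1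
- l`. -/

/-- The traceless matrix `(a b; c -a)`. -/
def mk (a b c : ℂ) : g :=
  ⟨!![a, b; c, -a], LinearMap.mem_ker.2 (by simp [Matrix.trace_fin_two])⟩

/-- The coroot vector of `𝔤`. -/
def h : g := mk 1 0 0

/-- The lowest root vector of `𝔤`. -/
def f : g := mk 0 0 1

/-- The entry of a traceless matrix as a linear form. -/
def entry (i j : Fin 2) : g →ₗ[ℂ] ℂ where
  toFun x := (x : Matrix (Fin 2) (Fin 2) ℂ) i j
  map_add' _ _ := rfl
  map_smul' _ _ := rfl

theorem entry_one_one (x : g) : entry 1 1 x = -entry 0 0 x := trace_entry x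

theorem ext_entry {x y : g} (h₀ : entry 0 0 x = entry 0 0 y) (h₁ : entry 0 1 x = entry 0 1 y)
    (h₂ : entry 1 0 x = entry 1 0 y) : x = y := by
  apply Subtype.ext
  ext i j
  fin_cases i <;> fin_cases j
  · exact h₀
  · exact h₁
  · exact h₂
  · change entry 1 1 x = entry 1 1 y
    rw [entry_one_one, entry_one_one, h₀]

@[simp] theorem entry_mk_zero_zero (a b c : ℂ) : entry 0 0 (mk a b c) = a := rfl
@[simp] theorem entry_mk_zero_one (a b c : ℂ) : entry 0 1 (mk a b c) = b := rfl
@[simp] theorem entry_mk_one_zero (a b c : ℂ) : entry 1 0 (mk a b c) = c := rfl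

theorem entry_lie (i j : Fin 2) (x y : g) : entry i j ⁅x, y⁆ =
    entry i 0 x * entry 0 j y + entry i 1 x * entry 1 j y
      - (entry i 0 y * entry 0 j x + entry i 1 y * entry 1 j x) := by
  change (⁅x, y⁆ : g).val i j = _
  rw [LieAlgebra.SpecialLinear.sl_bracket, Matrix.sub_apply, Matrix.mul_apply, Matrix.mul_apply,
    Fin.sum_univ_two, Fin.sum_univ_two]
  rfl

theorem e_eq : e = mk 0 1 0 := by
  apply Subtype.ext
  ext i j
  fin_cases i <;> fin_cases j <;> simp [e, mk]

theorem eq_combination (x : g) : x = entry 0 1 x • e + entry 0 0 x • h + entry 1 0 x • f := by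
  rw [e_eq]
  apply ext_entry <;> simp [h, f]

theorem lie_h_e : ⁅h, e⁆ = (2 : ℂ) • e := by
  rw [e_eq]
  apply ext_entry <;> simp [h, entry_lie, entry_one_one]; norm_num

theorem lie_h_f : ⁅h, f⁆ = (-2 : ℂ) • f := by
  apply ext_entry <;> simp [h, f, entry_lie, entry_one_one]; norm_num

theorem lie_e_f : ⁅e, f⁆ = h := by
  rw [e_eq]
  apply ext_entry <;> simp [h, f, entry_lie, entry_one_one]

/-- The coordinates `(a, b, c)` of `(a b; c -a)`. -/
def coords : g ≃ₗ[ℂ] (Fin 3 → ℂ) where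
  toFun x := ![entry 0 0 x, entry 0 1 x, entry 1 0 x]
  map_add' x y := by ext i; fin_cases i <;> simp
  map_smul' c x := by ext i; fin_cases i <;> simp
  invFun v := mk (v 0) (v 1) (v 2)
  left_inv x := by apply ext_entry <;> simp
  right_inv v := by ext i; fin_cases i <;> simp

theorem killingForm_eq (x y : g) : killingForm ℂ g x y =
    8 * (entry 0 0 x * entry 0 0 y) + 4 * (entry 0 1 x * entry 1 0 y + entry 1 0 x * entry 0 1 y) := by
  rw [killingForm_apply_apply, LinearMap.trace_eq_matrix_trace ℂ (Module.Basis.ofEquivFun coords),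
    Matrix.trace, Fin.sum_univ_three]
  have hb (i : Fin 3) : Module.Basis.ofEquivFun coords i = mk ((Pi.single i 1 : Fin 3 → ℂ) 0)
      ((Pi.single i 1 : Fin 3 → ℂ) 1) ((Pi.single i 1 : Fin 3 → ℂ) 2) := by
    rw [Module.Basis.coe_ofEquivFun]
    rfl
  simp only [Matrix.diag_apply, LinearMap.toMatrix_apply, hb, Module.Basis.ofEquivFun_repr_apply]
  simp [coords, entry_lie, entry_one_one]
  ring

/-! ### The minimal orbit closure as a quotient of the plane -/

/-- Polynomials in two variables. -/
abbrev P : Type := MvPolynomial (Fin 2) ℂ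

/-- The first coordinate of the plane. -/
abbrev u : P := MvPolynomial.X 0

/-- The second coordinate of the plane. -/
abbrev v : P := MvPolynomial.X 1

/-- The quadratic form on the plane attached to an element of `𝔤`. -/
def quad : g →ₗ[ℂ] P :=
  (entry 1 0).smulRight (u ^ 2) - (entry 0 0).smulRight (2 * u * v) -
    (entry 0 1).smulRight (v ^ 2)

theorem quad_apply (x : g) : quad x = MvPolynomial.C (entry 1 0 x) * u ^ 2 -
    MvPolynomial.C (entry 0 0 x) * (2 * u * v) - MvPolynomial.C (entry 0 1 x) * v ^ 2 := by
  simp [quad, MvPolynomial.smul_eq_C_mul]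

theorem quad_e : quad e = -v ^ 2 := by simp [quad_apply, e_eq]
theorem quad_h : quad h = -(2 * u * v) := by simp [quad_apply, h]
theorem quad_f : quad f = u ^ 2 := by simp [quad_apply, f]

/-- The pull-back of functions on `𝔤*` to the plane. -/
def rhoS : S →ₐ[ℂ] P := SymmetricAlgebra.lift quad

@[simp] theorem rhoS_ι (x : g) : rhoS (SymmetricAlgebra.ι ℂ g x) = quad x := by simp [rhoS]

/-- The parametrization of the orbit closure by the plane. -/
def orbitPoint (p : Fin 2 → ℂ) : g := mk (-(p 0 * p 1)) (p 0 ^ 2) (-(p 1 ^ 2))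

/-- The Killing form is four times the trace form, and `quad x` is quadratic, so the factor four is
absorbed in evaluating at `2p`. -/
theorem lift_orbitPoint (p : Fin 2 → ℂ) (a : S) :
    SymmetricAlgebra.lift (killingForm ℂ g (orbitPoint p)) a =
      MvPolynomial.eval (fun i => 2 * p i) (rhoS a) := by
  have : SymmetricAlgebra.lift (killingForm ℂ g (orbitPoint p)) =
      (MvPolynomial.aeval (fun i => 2 * p i)).comp rhoS := by
    apply SymmetricAlgebra.algHom_ext
    ext x
    simp [killingForm_eq, orbitPoint, quad_apply]
    ring
  rw [this, AlgHom.comp_apply, MvPolynomial.aeval_eq_eval]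

theorem mem_Omin_iff (ξ : Module.Dual ℂ g) :
    ξ ∈ Omin ↔ ∃ p : Fin 2 → ℂ, p ≠ 0 ∧ ξ = killingForm ℂ g (orbitPoint p) := by
  -- The conjugate of `e` by `γ` depends only on the first column of `γ`; hence the orbit is the
  -- image of the punctured plane.
  have key (γ : Matrix.SpecialLinearGroup (Fin 2) ℂ) :
      (orbitPoint (fun i => γ i 0) : Matrix (Fin 2) (Fin 2) ℂ) =
      (γ : Matrix (Fin 2) (Fin 2) ℂ) * (e : Matrix (Fin 2) (Fin 2) ℂ) *
        ((γ⁻¹ : Matrix.SpecialLinearGroup (Fin 2) ℂ) : Matrix (Fin 2) (Fin 2) ℂ) := by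
    rw [Matrix.SpecialLinearGroup.coe_inv, Matrix.adjugate_fin_two, e_eq]
    ext i j
    fin_cases i <;> fin_cases j <;>
      simp [orbitPoint, mk, Matrix.mul_apply, Fin.sum_univ_two] <;> ring
  constructor
  · rintro ⟨γ, y, hy, rfl⟩
    refine ⟨fun i => γ i 0, ?_, ?_⟩
    · intro hp
      have h₀ := congrFun hp 0
      have h₁ := congrFun hp 1
      have hd := γ.det_coe
      rw [Matrix.det_fin_two] at hd
      simp only [Pi.zero_apply] at h₀ h₁
      rw [h₀, h₁] at hd
      simp at hd
    · congr 1
      apply Subtype.ext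
      rw [hy, key]
  · rintro ⟨p, hp, rfl⟩
    obtain ⟨γ, hγ⟩ : ∃ γ : Matrix.SpecialLinearGroup (Fin 2) ℂ, (fun i => γ i 0) = p := by
      by_cases h0 : p 0 = 0
      · have h1 : p 1 ≠ 0 := by
          intro h1
          apply hp
          ext i
          fin_cases i <;> simp [h0, h1]
        refine ⟨⟨!![p 0, -(p 1)⁻¹; p 1, 0], ?_⟩, ?_⟩
        · simp [Matrix.det_fin_two, h1]
        · ext i
          fin_cases i <;> simp
      · refine ⟨⟨!![p 0, 0; p 1, (p 0)⁻¹], ?_⟩, ?_⟩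
        · simp [Matrix.det_fin_two, h0]
        · ext i
          fin_cases i <;> simp
    refine ⟨γ, orbitPoint p, ?_, rfl⟩
    rw [← hγ, key]

theorem mem_I_iff (a : S) : a ∈ I ↔ rhoS a = 0 := by
  change (∀ ξ ∈ Omin, SymmetricAlgebra.lift ξ a = 0) ↔ _
  constructor
  · intro ha
    have hz (p : Fin 2 → ℂ) (hp : p ≠ 0) : MvPolynomial.eval p (rhoS a) = 0 := by
      have h2 : (fun i => p i / 2) ≠ 0 := by
        intro h0
        apply hp
        ext i
        have := congrFun h0 i
        simpa using this
      have := ha _ ((mem_Omin_iff _).2 ⟨_, h2, rfl⟩)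
      rw [lift_orbitPoint] at this
      have hp2 : (fun i => 2 * (p i / 2)) = p := by
        ext i
        ring
      rwa [hp2] at this
    -- So far `rhoS a` vanishes only off the origin; the factor `u` covers the origin and cancels in
    -- a domain.
    have hu : u * rhoS a = 0 := by
      apply MvPolynomial.funext
      intro p
      by_cases hp : p = 0
      · simp [hp]
      · simp [hz p hp]
    exact (mul_eq_zero.1 hu).resolve_left (MvPolynomial.X_ne_zero 0)
  · rintro ha ξ hξ
    obtain ⟨p, -, rfl⟩ := (mem_Omin_iff ξ).1 hξ
    rw [lift_orbitPoint, ha, map_zero]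

/-- The coordinate ring of the orbit closure as a ring of functions on the plane. -/
def rho : R →ₐ[ℂ] P := Ideal.Quotient.liftₐ I rhoS (fun a ha => (mem_I_iff a).1 ha)

@[simp] theorem rho_proj (a : S) : rho (proj a) = rhoS a := rfl

@[simp] theorem rho_mom (x : g) : rho (mom x) = quad x := rhoS_ι x

theorem proj_surjective : Function.Surjective proj := Ideal.Quotient.mk_surjective

theorem rho_injective : Function.Injective rho := by
  rw [injective_iff_map_eq_zero]
  intro r hr
  obtain ⟨a, rfl⟩ := proj_surjective r
  exact Ideal.Quotient.eq_zero_iff_mem.2 ((mem_I_iff a).2 hr)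

/-! ### The Poisson bracket in the plane -/

/-- The derivative with respect to the first coordinate. -/
abbrev du : Derivation ℂ P P := MvPolynomial.pderiv 0

/-- The derivative with respect to the second coordinate. -/
abbrev dv : Derivation ℂ P P := MvPolynomial.pderiv 1

theorem du_dv (F : P) : du (dv F) = dv (du F) := by
  have : ⁅du, dv⁆ = 0 := by
    apply MvPolynomial.derivation_ext
    intro i
    fin_cases i <;> simp [Derivation.commutator_apply, MvPolynomial.pderiv_X]
  have h2 := DFunLike.congr_fun this F
  rw [Derivation.commutator_apply] at h2
  exact sub_eq_zero.1 h2

@[simp] theorem du_u : du u = 1 := MvPolynomial.pderiv_X_self 0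
@[simp] theorem dv_v : dv v = 1 := MvPolynomial.pderiv_X_self 1
@[simp] theorem du_v : du v = 0 := MvPolynomial.pderiv_X_of_ne (by decide)
@[simp] theorem dv_u : dv u = 0 := MvPolynomial.pderiv_X_of_ne (by decide)

/-- The Hamiltonian vector field of a function on the plane. -/
def ham (F : P) : Derivation ℂ P P :=
  (MvPolynomial.C (-1 / 2 : ℂ) : P) • (du F • dv - dv F • du)

theorem ham_apply (F G : P) :
    ham F G = MvPolynomial.C (-1 / 2 : ℂ) * (du F * dv G - dv F * du G) := by
  simp [ham]

theorem C_half_mul_two : (MvPolynomial.C (-1 / 2 : ℂ) : P) * 2 = -1 := by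
  rw [show (2 : P) = MvPolynomial.C 2 from (map_ofNat _ 2).symm, ← map_mul, ← map_one MvPolynomial.C,
    ← map_neg]
  norm_num

@[simp] theorem derivation_two (D : Derivation ℂ P P) : D 2 = 0 := by
  rw [show (2 : P) = algebraMap ℂ P 2 from (map_ofNat _ 2).symm, D.map_algebraMap]

theorem ham_quad (x : g) (G : P) : ham (quad x) G =
    -(MvPolynomial.C (entry 0 1 x) * (v * du G)) +
      MvPolynomial.C (entry 0 0 x) * (v * dv G - u * du G) -
      MvPolynomial.C (entry 1 0 x) * (u * dv G) := by
  rw [ham_apply, quad_apply]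
  simp only [map_sub, Derivation.leibniz, Derivation.leibniz_pow, MvPolynomial.pderiv_C, derivation_two,
    smul_eq_mul, du_u, dv_v, du_v, dv_u, nsmul_eq_mul]
  push_cast
  linear_combination (MvPolynomial.C (entry 1 0 x) * (u * dv G) -
    MvPolynomial.C (entry 0 0 x) * (v * dv G - u * du G) +
    MvPolynomial.C (entry 0 1 x) * (v * du G)) * C_half_mul_two

/-- Both sides are derivations in `a`, so generators suffice. The factor `-1/2` in `ham` is what
makes `quad` a Lie homomorphism: the canonical bracket of `-v²` and `u²` is `4uv`, while `quad h =
-2uv`. -/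
theorem rhoS_poisson_ι (x : g) (a : S) :
    rhoS (poisson (SymmetricAlgebra.ι ℂ g x) a) = ham (quad x) (rhoS a) := by
  rw [poisson, symDer_ι]
  change rhoS (symDer _ a) = _
  induction a using SymmetricAlgebra.induction with
  | algebraMap r => simp
  | ι y =>
    rw [symDer_ι, rhoS_ι, ham_quad]
    simp [quad_apply, entry_lie, entry_one_one, Derivation.leibniz, Derivation.leibniz_pow]
    ring
  | mul a b ha hb => simp [ha, hb]
  | add a b ha hb => simp [ha, hb]

theorem rhoS_poisson (a b : S) : rhoS (poisson a b) = ham (rhoS a) (rhoS b) := by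
  induction a using SymmetricAlgebra.induction with
  | algebraMap r => simp [poisson, ham_apply]
  | ι x => rw [rhoS_poisson_ι, rhoS_ι]
  | mul a b ha hb =>
    simp only [poisson] at *
    simp only [Derivation.leibniz, map_add, smul_eq_mul, map_mul, ha, hb, ham_apply]
    ring
  | add a b ha hb =>
    simp only [poisson] at *
    simp only [map_add, ha, hb, ham_apply]
    ring

/-! ### The grading of `R` in the plane -/

theorem Rgr_natCast (k : ℕ) : Rgr k = (LinearMap.range mom) ^ k := by simp [Rgr]

theorem Rgr_of_neg {d : ℤ} (hd : d < 0) : Rgr d = ⊥ := by simp [Rgr, hd]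

theorem one_mem_Rgr : (1 : R) ∈ Rgr 0 := by
  rw [show (0 : ℤ) = (0 : ℕ) from rfl, Rgr_natCast, pow_zero]
  exact Submodule.one_le.1 le_rfl

theorem mom_mem_Rgr (x : g) : mom x ∈ Rgr 1 := by
  rw [show (1 : ℤ) = (1 : ℕ) from rfl, Rgr_natCast, pow_one]
  exact ⟨x, rfl⟩

theorem monomial_eq_u_v (m : Fin 2 →₀ ℕ) (c : ℂ) :
    (MvPolynomial.monomial m c : P) = MvPolynomial.C c * (u ^ m 0 * v ^ m 1) := by
  rw [MvPolynomial.monomial_eq, Finsupp.prod_fintype _ _ (fun i => pow_zero _), Fin.prod_univ_two]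

theorem degree_fin_two (m : Fin 2 →₀ ℕ) : m.degree = m 0 + m 1 := by
  rw [Finsupp.degree_eq_sum, Fin.sum_univ_two]

theorem quad_isHomogeneous (x : g) : (quad x).IsHomogeneous 2 := by
  rw [quad_apply]
  have hu : u.IsHomogeneous 1 := MvPolynomial.isHomogeneous_X ℂ 0
  have hv : v.IsHomogeneous 1 := MvPolynomial.isHomogeneous_X ℂ 1
  have huv : (2 * u * v).IsHomogeneous 2 := by
    rw [show (2 : P) = MvPolynomial.C 2 from (map_ofNat _ 2).symm]
    exact (hu.C_mul 2).mul hv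
  exact (((hu.pow 2).C_mul _).sub (huv.C_mul _)).sub ((hv.pow 2).C_mul _)

/-- A factor `u²` or `v²` can be split off until only `1` or `uv` is left, and `uv` is the image of
`-h/2`. -/
theorem pow_mul_pow_mem (k i j : ℕ) (hij : i + j = 2 * k) :
    u ^ i * v ^ j ∈ (LinearMap.range quad) ^ k := by
  induction k generalizing i j with
  | zero =>
    obtain rfl : i = 0 := by omega
    obtain rfl : j = 0 := by omega
    rw [pow_zero, pow_zero, pow_zero, one_mul]
    exact Submodule.one_le.1 le_rfl
  | succ k ih =>
    rw [pow_succ']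
    rcases Nat.lt_or_ge i 2 with hi | hi
    · rcases Nat.lt_or_ge j 2 with hj | hj
      · obtain rfl : i = 1 := by omega
        obtain rfl : j = 1 := by omega
        obtain rfl : k = 0 := by omega
        rw [pow_zero, mul_one]
        refine ⟨mk (-1 / 2) 0 0, ?_⟩
        rw [quad_apply]
        simp only [entry_mk_zero_zero, entry_mk_zero_one, entry_mk_one_zero, map_zero]
        linear_combination (-u * v) * C_half_mul_two
      · obtain ⟨j, rfl⟩ := Nat.exists_eq_add_of_le hj
        rw [show u ^ i * v ^ (2 + j) = (-v ^ 2) * (-(u ^ i * v ^ j)) by ring]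
        exact Submodule.mul_mem_mul ⟨e, quad_e⟩ (neg_mem (ih i j (by omega)))
    · obtain ⟨i, rfl⟩ := Nat.exists_eq_add_of_le hi
      rw [show u ^ (2 + i) * v ^ j = u ^ 2 * (u ^ i * v ^ j) by ring]
      exact Submodule.mul_mem_mul ⟨f, quad_f⟩ (ih i j (by omega))

theorem map_rho_Rgr (k : ℕ) : (Rgr k).map rho.toLinearMap = (LinearMap.range quad) ^ k := by
  rw [Rgr_natCast, Submodule.map_pow, ← LinearMap.range_comp]
  congr 2
  ext x : 1
  exact rho_mom x

theorem range_quad_pow (k : ℕ) :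
    (LinearMap.range quad) ^ k = MvPolynomial.homogeneousSubmodule (Fin 2) ℂ (2 * k) := by
  apply le_antisymm
  · induction k with
    | zero =>
      rw [pow_zero, Submodule.one_le]
      exact MvPolynomial.isHomogeneous_one _ _
    | succ k ih =>
      rw [pow_succ, Submodule.mul_le]
      rintro F hF _ ⟨x, rfl⟩
      exact MvPolynomial.IsHomogeneous.mul (ih hF) (quad_isHomogeneous x)
  · intro F hF
    rw [F.as_sum]
    refine sum_mem fun m hm => ?_
    have hd := MvPolynomial.IsHomogeneous.degree_eq_sum_deg_support hF hm
    rw [monomial_eq_u_v, ← MvPolynomial.smul_eq_C_mul]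
    apply Submodule.smul_mem
    apply pow_mul_pow_mem
    rw [← degree_fin_two, hd]
    exact Finsupp.degree_apply m

theorem mem_Rgr_iff (k : ℕ) (r : R) : r ∈ Rgr k ↔ (rho r).IsHomogeneous (2 * k) := by
  rw [← MvPolynomial.mem_homogeneousSubmodule, ← range_quad_pow, ← map_rho_Rgr]
  constructor
  · exact fun hr => ⟨r, hr, rfl⟩
  · rintro ⟨r', hr', h'⟩
    rwa [← rho_injective h']

theorem exists_rho_eq_of_isHomogeneous {k : ℕ} {F : P} (hF : F.IsHomogeneous (2 * k)) :
    ∃ r, rho r = F := by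
  rw [← MvPolynomial.mem_homogeneousSubmodule, ← range_quad_pow, ← map_rho_Rgr] at hF
  obtain ⟨r, -, hr⟩ := hF
  exact ⟨r, hr⟩

theorem coeff_rho_of_odd (r : R) (m : Fin 2 →₀ ℕ) (hm : Odd m.degree) :
    (rho r).coeff m = 0 := by
  obtain ⟨a, rfl⟩ := proj_surjective r
  rw [rho_proj]
  induction a using SymmetricAlgebra.induction generalizing m with
  | algebraMap c =>
    rw [AlgHom.commutes, MvPolynomial.algebraMap_eq, MvPolynomial.coeff_C, if_neg]
    rintro rfl
    simp at hm
  | ι x =>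
    rw [rhoS_ι]
    apply (quad_isHomogeneous x).coeff_eq_zero
    intro h2
    rw [h2] at hm
    exact absurd hm (by decide)
  | mul a b ha hb =>
    rw [map_mul, MvPolynomial.coeff_mul]
    refine Finset.sum_eq_zero fun p hp => ?_
    rw [← Finset.HasAntidiagonal.mem_antidiagonal.1 hp, map_add, Nat.odd_add] at hm
    rcases Nat.even_or_odd p.2.degree with h2 | h2
    · rw [ha _ (hm.2 h2), zero_mul]
    · rw [hb _ h2, mul_zero]
  | add a b ha hb => rw [map_add, MvPolynomial.coeff_add, ha m hm, hb m hm, add_zero]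

theorem even_degree_of_mem_support {r : R} {m : Fin 2 →₀ ℕ} (hm : m ∈ (rho r).support) :
    Even m.degree := by
  by_contra h
  exact MvPolynomial.mem_support_iff.1 hm (coeff_rho_of_odd r m (Nat.not_even_iff_odd.1 h))

theorem exists_rho_eq_monomial {m : Fin 2 →₀ ℕ} (hm : Even m.degree) :
    ∃ r, rho r = MvPolynomial.monomial m 1 := by
  obtain ⟨k, hk⟩ := even_iff_two_dvd.1 hm
  exact exists_rho_eq_of_isHomogeneous (MvPolynomial.isHomogeneous_monomial 1 hk)

/-- An element of `R` lies in a submodule if the monomials that occur in it do. -/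
theorem mem_of_monomials (M : Submodule ℂ R) (r : R)
    (hM : ∀ m ∈ (rho r).support, ∀ r', rho r' = MvPolynomial.monomial m 1 → r' ∈ M) : r ∈ M := by
  have h' : ∀ m : (rho r).support, ∃ r', rho r' = MvPolynomial.monomial m.1 1 :=
    fun m => exists_rho_eq_monomial (even_degree_of_mem_support m.2)
  choose b hb using h'
  have hr : r = ∑ m : (rho r).support, (rho r).coeff m.1 • b m := by
    apply rho_injective
    rw [map_sum]
    conv_lhs => rw [(rho r).as_sum, ← Finset.sum_coe_sort]
    refine Finset.sum_congr rfl fun m _ => ?_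
    rw [map_smul, hb, MvPolynomial.smul_monomial, smul_eq_mul, mul_one]
  rw [hr]
  exact sum_mem fun m _ => M.smul_mem _ (hM m.1 m.2 _ (hb m))

/-- A submodule of `R` is everything if it contains the graded pieces. -/
theorem eq_top_of_Rgr_le (M : Submodule ℂ R) (hM : ∀ k : ℕ, Rgr k ≤ M) (r : R) : r ∈ M := by
  refine mem_of_monomials M r fun m hm r' hr' => ?_
  obtain ⟨k, hk⟩ := even_iff_two_dvd.1 (even_degree_of_mem_support hm)
  refine hM k ((mem_Rgr_iff k r').2 ?_)
  rw [hr']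
  exact MvPolynomial.isHomogeneous_monomial 1 hk

theorem monomial_single_zero_add_single_one (i j : ℕ) :
    (MvPolynomial.monomial (Finsupp.single 0 i + Finsupp.single 1 j) 1 : P) = u ^ i * v ^ j := by
  rw [monomial_eq_u_v]
  simp

/-- A submodule of `R` is everything if it contains the powers of the highest root vector and is
stable under the lowest root vector. -/
theorem eq_top_of_lowering (M : Submodule ℂ R) (he : ∀ k : ℕ, mom e ^ k ∈ M)
    (hf : ∀ r ∈ M, ∀ r', rho r' = ham (quad f) (rho r) → r' ∈ M) (r : R) : r ∈ M := by
  have key : ∀ i j k : ℕ, i + j = 2 * k → ∀ r', rho r' = u ^ i * v ^ j → r' ∈ M := by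
    intro i
    induction i with
    | zero =>
      intro j k hk r' hr'
      have : r' = (-1 : ℂ) ^ k • mom e ^ k := by
        apply rho_injective
        rw [hr', map_smul, map_pow, rho_mom, quad_e, show j = 2 * k by omega,
          MvPolynomial.smul_eq_C_mul, map_pow, map_neg, map_one, ← mul_pow, pow_mul]
        ring
      rw [this]
      exact M.smul_mem _ (he k)
    | succ i ih =>
      intro j k hk r' hr'
      obtain ⟨r₀, hr₀⟩ : ∃ r₀, rho r₀ = u ^ i * v ^ (j + 1) := by
        rw [← monomial_single_zero_add_single_one]
        apply exists_rho_eq_monomial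
        rw [degree_fin_two]
        simp
        exact ⟨k, by omega⟩
      have h₀ := ih (j + 1) k (by omega) r₀ hr₀
      have hj : ((j : ℂ) + 1) ≠ 0 := Nat.cast_add_one_ne_zero j
      -- Bracketing with `u²` acts as `-u ∂_v`, which sends `u^i v^(j+1)` to `-(j+1) u^(i+1) v^j`.
      have h1 : (-((j : ℂ) + 1)) • r' ∈ M := by
        refine hf r₀ h₀ _ ?_
        rw [map_smul, hr', hr₀, ham_quad, MvPolynomial.smul_eq_C_mul]
        simp [f, Derivation.leibniz, Derivation.leibniz_pow]
        ring
      have h2 := M.smul_mem (-((j : ℂ) + 1))⁻¹ h1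
      rwa [inv_smul_smul₀ (neg_ne_zero.2 hj)] at h2
  refine mem_of_monomials M r fun m hm r' hr' => ?_
  obtain ⟨k, hk⟩ := even_iff_two_dvd.1 (even_degree_of_mem_support hm)
  refine key (m 0) (m 1) k (by rw [← degree_fin_two, hk]) r' ?_
  rw [hr', monomial_eq_u_v, map_one, one_mul]

/-! ### Operators on `R` -/

/-- The operator on `R` induced by an operator on the plane that preserves it. -/
def descend (T : P →ₗ[ℂ] P) (hT : ∀ r, ∃ r', rho r' = T (rho r)) : Module.End ℂ R :=
  (LinearEquiv.ofInjective rho.toLinearMap rho_injective).symm.toLinearMap ∘ₗ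
    (T ∘ₗ rho.toLinearMap).codRestrict _ hT

theorem rho_descend (T : P →ₗ[ℂ] P) (hT : ∀ r, ∃ r', rho r' = T (rho r)) (r : R) :
    rho (descend T hT r) = T (rho r) :=
  congrArg Subtype.val
    ((LinearEquiv.ofInjective rho.toLinearMap rho_injective).apply_symm_apply ⟨T (rho r), hT r⟩)

/-- The derivation `{μ_x, ·}` of `R`. -/
def hamR (x : g) : Module.End ℂ R :=
  descend (ham (quad x)) fun r => by
    obtain ⟨a, rfl⟩ := proj_surjective r
    exact ⟨proj (poisson (SymmetricAlgebra.ι ℂ g x) a), rhoS_poisson_ι x a⟩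

@[simp] theorem rho_hamR (x : g) (r : R) : rho (hamR x r) = ham (quad x) (rho r) :=
  rho_descend _ _ r

theorem hamR_proj (x : g) (a : S) :
    hamR x (proj a) = proj (poisson (SymmetricAlgebra.ι ℂ g x) a) := by
  apply rho_injective
  rw [rho_hamR, rho_proj, rho_proj, rhoS_poisson_ι]

theorem hamR_mom (x y : g) : hamR x (mom y) = mom ⁅x, y⁆ := by
  change hamR x (proj (SymmetricAlgebra.ι ℂ g y)) = _
  rw [hamR_proj, poisson, symDer_ι]
  change proj (symDer _ _) = _
  rw [symDer_ι]
  rfl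

theorem hamR_mul (x : g) (r r' : R) : hamR x (r * r') = r * hamR x r' + r' * hamR x r := by
  apply rho_injective
  simp

theorem hamR_one (x : g) : hamR x 1 = 0 := by
  apply rho_injective
  simp

theorem ham_isHomogeneous (x : g) {n : ℕ} {F : P} (hF : F.IsHomogeneous n) :
    (ham (quad x) F).IsHomogeneous n := by
  have hX (i j : Fin 2) : ((MvPolynomial.X i : P) * MvPolynomial.pderiv j F).IsHomogeneous n := by
    rcases Nat.eq_zero_or_pos n with rfl | hn
    · rw [MvPolynomial.totalDegree_eq_zero_iff_eq_C.1
        ((MvPolynomial.totalDegree_zero_iff_isHomogeneous _).2 hF), MvPolynomial.pderiv_C, mul_zero]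
      exact MvPolynomial.isHomogeneous_zero _ _ _
    · have := (MvPolynomial.isHomogeneous_X ℂ i).mul (hF.pderiv (i := j))
      rwa [Nat.add_sub_cancel' hn] at this
  rw [ham_quad]
  exact (((hX 1 0).C_mul _).neg.add (((hX 1 1).sub (hX 0 0)).C_mul _)).sub ((hX 0 1).C_mul _)

theorem hamR_mem_Rgr (x : g) {d : ℤ} {r : R} (hr : r ∈ Rgr d) : hamR x r ∈ Rgr d := by
  rcases lt_or_ge d 0 with hd | hd
  · rw [Rgr_of_neg hd, Submodule.mem_bot] at *
    rw [hr, map_zero]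
  · lift d to ℕ using hd
    rw [mem_Rgr_iff] at *
    rw [rho_hamR]
    exact ham_isHomogeneous x hr

/-! ### The second order term of the multiplication by `μ_x` -/

/-- The second order operator with constant coefficients attached to an element of `𝔤`. -/
def diffTwo (x : g) : P →ₗ[ℂ] P :=
  -(entry 0 1 x • (du : P →ₗ[ℂ] P) ∘ₗ (du : P →ₗ[ℂ] P)) +
    (2 * entry 0 0 x) • (du : P →ₗ[ℂ] P) ∘ₗ (dv : P →ₗ[ℂ] P) +
    entry 1 0 x • (dv : P →ₗ[ℂ] P) ∘ₗ (dv : P →ₗ[ℂ] P)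

theorem diffTwo_apply (x : g) (F : P) : diffTwo x F =
    -(MvPolynomial.C (entry 0 1 x) * du (du F)) +
      2 * MvPolynomial.C (entry 0 0 x) * du (dv F) +
      MvPolynomial.C (entry 1 0 x) * dv (dv F) := by
  simp only [diffTwo, LinearMap.add_apply, LinearMap.neg_apply, LinearMap.smul_apply,
    LinearMap.comp_apply, Derivation.coeFn_coe, MvPolynomial.smul_eq_C_mul, map_mul, map_ofNat]

theorem diffTwo_isHomogeneous (x : g) {n : ℕ} {F : P} (hF : F.IsHomogeneous n) :
    (diffTwo x F).IsHomogeneous (n - 2) := by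
  have h2 (i j : Fin 2) :
      (MvPolynomial.pderiv i (MvPolynomial.pderiv j F)).IsHomogeneous (n - 2) :=
    (hF.pderiv (i := j)).pderiv (i := i)
  rw [diffTwo_apply, show (2 : P) = MvPolynomial.C 2 from (map_ofNat _ 2).symm, ← map_mul]
  exact (((h2 0 0).C_mul _).neg.add ((h2 0 1).C_mul _)).add ((h2 1 1).C_mul _)

theorem diffTwo_comm (x y : g) (F : P) :
    diffTwo x (diffTwo y F) = diffTwo y (diffTwo x F) := by
  simp only [diffTwo_apply, map_add, map_neg, Derivation.leibniz, MvPolynomial.pderiv_C,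
    derivation_two, smul_eq_mul, du_dv, map_zero]
  ring

/-- `diffTwo y` is `quad y` with `u, v` replaced by `∂_v, -∂_u`, a substitution that commutes with
the action of `𝔤`. Both sides are therefore `diffTwo ⁅x, y⁆`. -/
theorem ham_diffTwo (x y : g) (F : P) :
    ham (quad x) (diffTwo y F) - diffTwo y (ham (quad x) F) =
      diffTwo x (ham (quad y) F) - ham (quad y) (diffTwo x F) := by
  simp only [diffTwo_apply, ham_quad, map_add, map_sub, map_neg, Derivation.leibniz,
    MvPolynomial.pderiv_C, derivation_two, smul_eq_mul, du_dv, du_u, du_v, dv_u, dv_v, map_zero,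
    Derivation.map_one_eq_zero]
  ring

/-- `hF` is Euler's identity in degree `n`; `cn` and `cm` stand for the scaling factors in degrees
`n` and `n + 2`. By Euler's identity for the first derivatives of `F`, the second order terms reduce
to first order ones, and `hc` is the resulting condition on the factors. -/
theorem quad_diffTwo (x y : g) {n cn cm : ℂ} {F : P}
    (hF : u * du F + v * dv F = MvPolynomial.C n * F)
    (hc : cn * (n - 1) - cm * (n + 3) = -1 / 4) :
    quad x * (MvPolynomial.C cn * diffTwo y F) - MvPolynomial.C cm * diffTwo y (quad x * F) +
        (MvPolynomial.C cm * diffTwo x (quad y * F) - quad y * (MvPolynomial.C cn * diffTwo x F)) =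
      MvPolynomial.C (1 / 4) *
        (ham (quad x) (ham (quad y) F) - ham (quad y) (ham (quad x) F)) := by
  have hu : u * du (du F) + v * dv (du F) = (MvPolynomial.C n - 1) * du F := by
    have := congrArg du hF
    simp only [map_add, Derivation.leibniz, MvPolynomial.pderiv_C, smul_eq_mul, du_dv, du_u,
      du_v] at this
    linear_combination this
  have hv : u * dv (du F) + v * dv (dv F) = (MvPolynomial.C n - 1) * dv F := by
    have := congrArg dv hF
    simp only [map_add, Derivation.leibniz, MvPolynomial.pderiv_C, smul_eq_mul, dv_v, dv_u] at this
    linear_combination this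
  have hK : (MvPolynomial.C cn * (MvPolynomial.C n - 1) - MvPolynomial.C cm * (MvPolynomial.C n + 3) :
      P) + MvPolynomial.C (1 / 4) = 0 := by
    rw [show (3 : P) = MvPolynomial.C 3 from (map_ofNat _ 3).symm,
      show (1 : P) = MvPolynomial.C 1 from (map_one _).symm, ← map_sub, ← map_mul, ← map_add,
      ← map_mul, ← map_sub, hc, ← map_add]
    norm_num
  simp only [ham_quad]
  simp only [quad_apply, diffTwo_apply, map_add, map_sub, map_neg, Derivation.leibniz,
    MvPolynomial.pderiv_C, derivation_two, smul_eq_mul, du_dv, du_u, du_v, dv_u, dv_v, map_zero,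
    Derivation.map_one_eq_zero, Derivation.leibniz_pow, nsmul_eq_mul, Nat.cast_ofNat]
  -- Both sides alternate in `x, y`, so only the three `2 × 2` minors of their coordinates occur.
  linear_combination
    (MvPolynomial.C (entry 0 1 x) * MvPolynomial.C (entry 1 0 y) -
      MvPolynomial.C (entry 1 0 x) * MvPolynomial.C (entry 0 1 y)) *
      ((MvPolynomial.C cn - MvPolynomial.C cm) * (u * hu - v * hv) + (u * du F - v * dv F) * hK) +
    (MvPolynomial.C (entry 0 0 x) * MvPolynomial.C (entry 0 1 y) -
      MvPolynomial.C (entry 0 1 x) * MvPolynomial.C (entry 0 0 y)) *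
      (2 * v * ((MvPolynomial.C cn - MvPolynomial.C cm) * hu + du F * hK)) -
    (MvPolynomial.C (entry 0 0 x) * MvPolynomial.C (entry 1 0 y) -
      MvPolynomial.C (entry 1 0 x) * MvPolynomial.C (entry 0 0 y)) *
      (2 * u * ((MvPolynomial.C cn - MvPolynomial.C cm) * hv + dv F * hK))

/-- The operator that multiplies the homogeneous polynomials of degree `n` by `c n`. -/
def scaleDegree (c : ℕ → ℂ) : P →ₗ[ℂ] P :=
  (MvPolynomial.basisMonomials (Fin 2) ℂ).constr ℂ
    (fun m => MvPolynomial.monomial m (c m.degree))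

theorem scaleDegree_of_isHomogeneous (c : ℕ → ℂ) {n : ℕ} {F : P} (hF : F.IsHomogeneous n) :
    scaleDegree c F = MvPolynomial.C (c n) * F := by
  have h1 (m : Fin 2 →₀ ℕ) (a : ℂ) : scaleDegree c (MvPolynomial.monomial m a) =
      MvPolynomial.C (c m.degree) * MvPolynomial.monomial m a := by
    have h0 : scaleDegree c (MvPolynomial.monomial m 1) = MvPolynomial.monomial m (c m.degree) := by
      exact (MvPolynomial.basisMonomials (Fin 2) ℂ).constr_basis ℂ _ m
    rw [← mul_one a, ← smul_eq_mul, ← MvPolynomial.smul_monomial, map_smul, h0,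
      ← MvPolynomial.smul_eq_C_mul]
    simp [MvPolynomial.smul_monomial, mul_comm]
  rw [F.as_sum, map_sum, Finset.mul_sum]
  refine Finset.sum_congr rfl fun m hm => ?_
  rw [h1, Finsupp.degree_apply, ← hF.degree_eq_sum_deg_support hm]

/-- The coefficients of the second order terms; `τ` is the parameter of the family. -/
def coef (τ : ℂ) (n : ℕ) : ℂ := ((n : ℂ) ^ 2 - τ) / (16 * ((n : ℂ) ^ 2 - 1))

/-- Multiplied by `n ∓ 1`, the denominators of the two terms both become `16(n + 1)`, so `τ` cancels
and `n² - (n + 2)²` remains. Only even `n` occurs in `R`, which keeps `n² - 1` away from zero. -/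
theorem coef_rec (τ : ℂ) (k : ℕ) :
    coef τ (2 * k) * (((2 * k : ℕ) : ℂ) - 1) - coef τ (2 * k + 2) * (((2 * k : ℕ) : ℂ) + 3) =
      -1 / 4 := by
  have h1 : (2 * (k : ℂ) - 1) ≠ 0 := by
    intro h0
    have : ((2 * (k : ℤ) - 1 : ℤ) : ℂ) = 0 := by push_cast; exact h0
    have := Int.cast_eq_zero.1 this
    omega
  have h2 : (2 * (k : ℂ) + 1) ≠ 0 := by exact_mod_cast Nat.succ_ne_zero (2 * k)
  have h3 : (2 * (k : ℂ) + 3) ≠ 0 := by exact_mod_cast Nat.succ_ne_zero (2 * k + 2)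
  have e1 : ((2 * k : ℕ) : ℂ) ^ 2 - 1 = (2 * (k : ℂ) - 1) * (2 * (k : ℂ) + 1) := by
    push_cast; ring
  have e2 : ((2 * k + 2 : ℕ) : ℂ) ^ 2 - 1 = (2 * (k : ℂ) + 1) * (2 * (k : ℂ) + 3) := by
    push_cast; ring
  rw [coef, coef, e1, e2]
  push_cast
  field_simp
  ring

theorem exists_rho_eq_diffTwo (c : ℕ → ℂ) (x : g) (r : R) :
    ∃ r', rho r' = (diffTwo x ∘ₗ scaleDegree c) (rho r) := by
  let M : Submodule ℂ R := (LinearMap.range rho.toLinearMap).comap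
    (diffTwo x ∘ₗ scaleDegree c ∘ₗ rho.toLinearMap)
  refine eq_top_of_Rgr_le M (fun k r hr => ?_) r
  rw [mem_Rgr_iff] at hr
  change ∃ r', rho r' = diffTwo x (scaleDegree c (rho r))
  rw [scaleDegree_of_isHomogeneous _ hr]
  -- At `k = 0` the truncated differences `k - 1` and `2k - 2` are both zero, so the same formula
  -- serves.
  apply exists_rho_eq_of_isHomogeneous (k := k - 1)
  rw [show 2 * (k - 1) = 2 * k - 2 by omega]
  exact diffTwo_isHomogeneous x (hr.C_mul _)

/-- The second order part of the multiplication by `μ_x`. -/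
def lam (τ : ℂ) (x : g) : Module.End ℂ R :=
  descend (diffTwo x ∘ₗ scaleDegree (coef τ)) (exists_rho_eq_diffTwo _ x)

theorem rho_lam (τ : ℂ) (x : g) {k : ℕ} {r : R} (hr : r ∈ Rgr k) :
    rho (lam τ x r) = MvPolynomial.C (coef τ (2 * k)) * diffTwo x (rho r) := by
  rw [lam, rho_descend, LinearMap.comp_apply,
    scaleDegree_of_isHomogeneous _ ((mem_Rgr_iff k r).1 hr), ← MvPolynomial.smul_eq_C_mul, map_smul,
    MvPolynomial.smul_eq_C_mul]

theorem lam_mem_Rgr (τ : ℂ) (x : g) {d : ℤ} {r : R} (hr : r ∈ Rgr d) :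
    lam τ x r ∈ Rgr (d - 1) := by
  rcases lt_or_ge d 0 with hd | hd
  · rw [Rgr_of_neg hd, Submodule.mem_bot] at hr
    rw [hr, map_zero]
    exact zero_mem _
  · lift d to ℕ using hd
    rcases d with _ | k
    · rw [Rgr_of_neg (by simp), Submodule.mem_bot]
      apply rho_injective
      rw [rho_lam τ x hr, map_zero]
      rw [Rgr_natCast, pow_zero, Submodule.mem_one] at hr
      obtain ⟨c, rfl⟩ := hr
      simp [diffTwo_apply]
    · rw [show ((k + 1 : ℕ) : ℤ) - 1 = (k : ℕ) by push_cast; ring, mem_Rgr_iff, rho_lam τ x hr]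
      exact (diffTwo_isHomogeneous x ((mem_Rgr_iff _ r).1 hr)).C_mul _

theorem lam_one (τ : ℂ) (x : g) : lam τ x 1 = 0 := by
  have := lam_mem_Rgr τ x one_mem_Rgr
  rwa [Rgr_of_neg (by norm_num), Submodule.mem_bot] at this

theorem mul_mem_Rgr (x : g) {d : ℤ} {r : R} (hr : r ∈ Rgr d) : mom x * r ∈ Rgr (d + 1) := by
  rcases lt_or_ge d 0 with hd | hd
  · rw [Rgr_of_neg hd, Submodule.mem_bot] at hr
    rw [hr, mul_zero]
    exact zero_mem _
  · lift d to ℕ using hd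
    rw [show ((d : ℤ) + 1) = (d + 1 : ℕ) by push_cast; ring]
    rw [Rgr_natCast] at *
    rw [pow_succ']
    exact Submodule.mul_mem_mul ⟨x, rfl⟩ hr

/-- Multiplication by `μ_x` on `R`. -/
def mulMom (x : g) : Module.End ℂ R := LinearMap.mulLeft ℂ (mom x)

@[simp] theorem mulMom_apply (x : g) (r : R) : mulMom x r = mom x * r := rfl

theorem end_ext_Rgr {T T' : Module.End ℂ R} (hT : ∀ k : ℕ, ∀ r ∈ Rgr k, T r = T' r) : T = T' := by
  ext r
  exact eq_top_of_Rgr_le (LinearMap.eqLocus T T') hT r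

theorem hamR_mulMom (x y : g) :
    hamR x * mulMom y - mulMom y * hamR x = mulMom x * hamR y - hamR y * mulMom x := by
  ext r
  simp only [LinearMap.sub_apply, Module.End.mul_apply, mulMom_apply, hamR_mul, hamR_mom]
  rw [← lie_skew x y, map_neg]
  ring

theorem hamR_lam (τ : ℂ) (x y : g) :
    hamR x * lam τ y - lam τ y * hamR x = lam τ x * hamR y - hamR y * lam τ x := by
  apply end_ext_Rgr
  intro k r hr
  apply rho_injective
  simp only [LinearMap.sub_apply, Module.End.mul_apply, map_sub, rho_hamR, rho_lam τ _ hr,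
    rho_lam τ _ (hamR_mem_Rgr _ hr), ← MvPolynomial.smul_eq_C_mul, Derivation.map_smul]
  rw [← smul_sub, ham_diffTwo, smul_sub]

theorem lam_comm (τ : ℂ) (x y : g) : lam τ x * lam τ y = lam τ y * lam τ x := by
  apply end_ext_Rgr
  intro k r hr
  apply rho_injective
  rcases k with _ | k
  · have h0 (z : g) : lam τ z r = 0 := by
      have := lam_mem_Rgr τ z hr
      rwa [Rgr_of_neg (by simp), Submodule.mem_bot] at this
    simp [h0]
  · have h1 (z : g) : lam τ z r ∈ Rgr k := by
      have := lam_mem_Rgr τ z hr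
      rwa [show ((k + 1 : ℕ) : ℤ) - 1 = (k : ℕ) by push_cast; ring] at this
    simp only [Module.End.mul_apply, rho_lam τ _ (h1 _), rho_lam τ _ hr, ← MvPolynomial.smul_eq_C_mul,
      map_smul, diffTwo_comm x y]

/-- This is the `t²` coefficient of the commutation of left and right multiplications, the only one
that constrains the values of `coef`; the others hold for any scaling by degree. -/
theorem mulMom_lam (τ : ℂ) (x y : g) :
    mulMom x * lam τ y - lam τ y * mulMom x + (lam τ x * mulMom y - mulMom y * lam τ x) =
      (1 / 4 : ℂ) • (hamR x * hamR y - hamR y * hamR x) := by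
  apply end_ext_Rgr
  intro k r hr
  apply rho_injective
  have h1 (z : g) : mom z * r ∈ Rgr ((k + 1 : ℕ)) := by
    have := mul_mem_Rgr z hr
    rwa [show (k : ℤ) + 1 = (k + 1 : ℕ) by push_cast; ring] at this
  have hE := ((mem_Rgr_iff k r).1 hr).sum_X_mul_pderiv
  rw [Fin.sum_univ_two, nsmul_eq_mul] at hE
  have hE' : u * du (rho r) + v * dv (rho r) = MvPolynomial.C ((2 * k : ℕ) : ℂ) * rho r := by
    rw [hE, map_natCast]
  simp only [LinearMap.add_apply, LinearMap.sub_apply, LinearMap.smul_apply, Module.End.mul_apply,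
    map_add, map_sub, map_smul, mulMom_apply, map_mul, rho_mom, rho_hamR, rho_lam τ _ (h1 _),
    rho_lam τ _ hr, MvPolynomial.smul_eq_C_mul]
  exact quad_diffTwo x y hE' (coef_rec τ k)

/-! ### Operators on `R[t]` -/

/-- The operator on `R[t]` that acts on the coefficient of `t^n` by `T n`. -/
def coeffwise (T : ℕ → Module.End ℂ R) : Module.End ℂ R[X] :=
  Polynomial.lsum fun n => ((Polynomial.monomial n).restrictScalars ℂ : R →ₗ[ℂ] R[X]) ∘ₗ T n

theorem coeffwise_monomial (T : ℕ → Module.End ℂ R) (n : ℕ) (r : R) :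
    coeffwise T (Polynomial.monomial n r) = Polynomial.monomial n (T n r) := by
  simp [coeffwise, Polynomial.lsum_apply, Polynomial.sum_monomial_index]

@[simp] theorem coeff_coeffwise (T : ℕ → Module.End ℂ R) (F : R[X]) (n : ℕ) :
    (coeffwise T F).coeff n = T n (F.coeff n) := by
  induction F using Polynomial.induction_on' with
  | add p q hp hq => simp only [map_add, Polynomial.coeff_add, hp, hq]
  | monomial m r =>
    rw [coeffwise_monomial, Polynomial.coeff_monomial, Polynomial.coeff_monomial]
    split_ifs with hm
    · rw [hm]
    · rw [map_zero]

/-- The extension of operators from `R` to `R[t]`. -/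
def extend (T : Module.End ℂ R) : Module.End ℂ R[X] := coeffwise fun _ => T

@[simp] theorem coeff_extend (T : Module.End ℂ R) (F : R[X]) (n : ℕ) :
    (extend T F).coeff n = T (F.coeff n) := coeff_coeffwise _ F n

theorem extend_C (T : Module.End ℂ R) (r : R) :
    extend T (Polynomial.C r) = Polynomial.C (T r) := coeffwise_monomial _ 0 r

theorem extend_mul (T T' : Module.End ℂ R) : extend (T * T') = extend T * extend T' := by
  ext F n : 2; simp

theorem extend_add (T T' : Module.End ℂ R) : extend (T + T') = extend T + extend T' := by
  ext F n : 2; simp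

theorem extend_sub (T T' : Module.End ℂ R) : extend (T - T') = extend T - extend T' := by
  ext F n : 2; simp

/-- Multiplication by `t` on `R[t]`. -/
def mulX : Module.End ℂ R[X] := LinearMap.mulLeft ℂ Polynomial.X

@[simp] theorem mulX_apply (F : R[X]) : mulX F = Polynomial.X * F := rfl

theorem mulX_commute (T : Module.End ℂ R) : Commute mulX (extend T) := by
  ext F n : 2
  cases n <;> simp

/-- The automorphism `t ↦ -t` of `R[t]`. -/
def flip : Module.End ℂ R[X] := coeffwise fun n => (-1 : ℂ) ^ n • 1

@[simp] theorem coeff_flip (F : R[X]) (n : ℕ) :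
    (flip F).coeff n = (-1 : ℂ) ^ n • F.coeff n := by
  simp [flip]

theorem flip_C (r : R) : flip (Polynomial.C r) = Polynomial.C r := by
  ext n
  cases n <;> simp [Polynomial.coeff_C]

theorem flip_mul_flip : flip * flip = 1 := by
  ext F n : 2
  simp [smul_smul, ← mul_pow]

theorem flip_mulX : flip * mulX = (-1 : ℂ) • (mulX * flip) := by
  ext F n : 2
  cases n <;> simp [pow_succ]

theorem flip_extend (T : Module.End ℂ R) : flip * extend T = extend T * flip := by
  ext F n : 2
  simp

/-- The hypotheses `h0` to `h4` are the vanishing of the coefficients of `t⁰` to `t⁴` in the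
commutator. -/
theorem commute_quadratic {Q : Type*} [Ring Q] {t a b c a' b' c' : Q}
    (ha : Commute t a) (hb : Commute t b) (hc : Commute t c)
    (ha' : Commute t a') (hb' : Commute t b') (hc' : Commute t c')
    (h0 : a * a' = a' * a) (h1 : b * a' - a' * b = a * b' - b' * a)
    (h2 : a * c' - c' * a + (c * a' - a' * c) = b * b' - b' * b)
    (h3 : b * c' - c' * b = c * b' - b' * c) (h4 : c * c' = c' * c) :
    Commute (a + t * b + t * (t * c)) (a' - t * b' + t * (t * c')) := by
  have key (z w : Q) (hz : Commute t z) : z * (t * w) = t * (z * w) := hz.symm.left_comm w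
  have e : (a + t * b + t * (t * c)) * (a' - t * b' + t * (t * c')) -
      (a' - t * b' + t * (t * c')) * (a + t * b + t * (t * c)) =
      (a * a' - a' * a) + t * ((b * a' - a' * b) - (a * b' - b' * a)) +
      t * (t * ((a * c' - c' * a + (c * a' - a' * c)) - (b * b' - b' * b))) +
      t * (t * (t * ((b * c' - c' * b) - (c * b' - b' * c)))) +
      t * (t * (t * (t * (c * c' - c' * c)))) := by
    simp only [mul_add, add_mul, mul_sub, sub_mul, mul_assoc, key _ _ ha, key _ _ hb, key _ _ hc,
      key _ _ ha', key _ _ hb', key _ _ hc']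
    abel
  rw [h0, h1, h2, h3, h4] at e
  simp only [sub_self, mul_zero, add_zero] at e
  exact sub_eq_zero.1 e

/-- The left multiplication by `μ_x`. -/
def leftMul (τ : ℂ) (x : g) : Module.End ℂ R[X] :=
  extend (mulMom x) + mulX * extend ((1 / 2 : ℂ) • hamR x) + mulX * (mulX * extend (lam τ x))

/-- The right multiplication by `μ_x`. -/
def rightMul (τ : ℂ) (x : g) : Module.End ℂ R[X] :=
  extend (mulMom x) - mulX * extend ((1 / 2 : ℂ) • hamR x) + mulX * (mulX * extend (lam τ x))

theorem leftMul_commute_rightMul (τ : ℂ) (x y : g) : Commute (leftMul τ x) (rightMul τ y) := by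
  apply commute_quadratic <;> try exact mulX_commute _
  · rw [← extend_mul, ← extend_mul]
    congr 1
    ext r
    simp only [Module.End.mul_apply, mulMom_apply]
    ring
  · rw [← extend_mul, ← extend_mul, ← extend_mul, ← extend_mul, ← extend_sub, ← extend_sub]
    simp only [smul_mul_assoc, mul_smul_comm, ← smul_sub, hamR_mulMom]
  · simp only [← extend_mul, ← extend_sub, ← extend_add]
    simp only [smul_mul_assoc, mul_smul_comm, ← smul_sub, mulMom_lam, smul_smul]
    norm_num
  · simp only [← extend_mul, ← extend_sub]
    simp only [smul_mul_assoc, mul_smul_comm, ← smul_sub, hamR_lam]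
  · rw [← extend_mul, ← extend_mul, lam_comm]

/-! ### The commuting algebras of left and right multiplications -/

/-- The algebra of left multiplications. -/
def leftAlg (τ : ℂ) : Subalgebra ℂ (Module.End ℂ R[X]) :=
  Algebra.adjoin ℂ (insert mulX (Set.range (leftMul τ)))

/-- The algebra of right multiplications. -/
def rightAlg (τ : ℂ) : Subalgebra ℂ (Module.End ℂ R[X]) :=
  Algebra.adjoin ℂ (insert mulX (Set.range (rightMul τ)))

theorem mulX_mem_leftAlg (τ : ℂ) : mulX ∈ leftAlg τ := Algebra.subset_adjoin (Set.mem_insert _ _)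

theorem mulX_mem_rightAlg (τ : ℂ) : mulX ∈ rightAlg τ := Algebra.subset_adjoin (Set.mem_insert _ _)

theorem leftMul_mem (τ : ℂ) (x : g) : leftMul τ x ∈ leftAlg τ :=
  Algebra.subset_adjoin (Set.mem_insert_of_mem _ ⟨x, rfl⟩)

theorem rightMul_mem (τ : ℂ) (x : g) : rightMul τ x ∈ rightAlg τ :=
  Algebra.subset_adjoin (Set.mem_insert_of_mem _ ⟨x, rfl⟩)

theorem mulX_commute_leftMul (τ : ℂ) (x : g) : Commute mulX (leftMul τ x) :=
  ((mulX_commute _).add_right ((Commute.refl _).mul_right (mulX_commute _))).add_right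
    ((Commute.refl _).mul_right ((Commute.refl _).mul_right (mulX_commute _)))

theorem mulX_commute_rightMul (τ : ℂ) (x : g) : Commute mulX (rightMul τ x) :=
  ((mulX_commute _).sub_right ((Commute.refl _).mul_right (mulX_commute _))).add_right
    ((Commute.refl _).mul_right ((Commute.refl _).mul_right (mulX_commute _)))

theorem leftAlg_commute_rightAlg {τ : ℂ} {a b : Module.End ℂ R[X]} (ha : a ∈ leftAlg τ)
    (hb : b ∈ rightAlg τ) : a * b = b * a := by
  induction ha using Algebra.adjoin_induction with
  | mem a ha =>
    induction hb using Algebra.adjoin_induction with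
    | mem b hb =>
      rcases ha with rfl | ⟨x, rfl⟩ <;> rcases hb with rfl | ⟨y, rfl⟩
      · rfl
      · exact mulX_commute_rightMul τ y
      · exact (mulX_commute_leftMul τ x).symm
      · exact leftMul_commute_rightMul τ x y
    | algebraMap r => exact (Algebra.commutes r a).symm
    | add b b' _ _ h₁ h₂ => rw [mul_add, add_mul, h₁, h₂]
    | mul b b' _ _ h₁ h₂ => rw [← mul_assoc, h₁, mul_assoc, h₂, mul_assoc]
  | algebraMap r => exact Algebra.commutes r b
  | add a a' _ _ h₁ h₂ => rw [mul_add, add_mul, h₁, h₂]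
  | mul a a' _ _ h₁ h₂ => rw [mul_assoc, h₂, ← mul_assoc, h₁, mul_assoc]

theorem leftMul_C (τ : ℂ) (x : g) (r : R) : leftMul τ x (Polynomial.C r) =
    Polynomial.C (mom x * r) + Polynomial.X * Polynomial.C ((1 / 2 : ℂ) • hamR x r) +
      Polynomial.X * (Polynomial.X * Polynomial.C (lam τ x r)) := by
  simp only [leftMul, LinearMap.add_apply, Module.End.mul_apply, extend_C, mulX_apply, mulMom_apply,
    LinearMap.smul_apply]

theorem leftMul_one (τ : ℂ) (x : g) : leftMul τ x 1 = Polynomial.C (mom x) := by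
  rw [← Polynomial.C_1, leftMul_C, hamR_one, lam_one]
  simp

theorem rightMul_one (τ : ℂ) (x : g) : rightMul τ x 1 = Polynomial.C (mom x) := by
  rw [← Polynomial.C_1]
  simp only [rightMul, LinearMap.add_apply, LinearMap.sub_apply, Module.End.mul_apply, extend_C,
    mulX_apply, mulMom_apply, LinearMap.smul_apply, hamR_one, lam_one]
  simp

/-- The elements of `R[t]` of total degree `n`, where `t` has degree one. -/
def totalGr (n : ℤ) : Submodule ℂ R[X] where
  carrier := {F | ∀ p : ℕ, F.coeff p ∈ Rgr (n - p)}
  add_mem' hF hG p := by rw [Polynomial.coeff_add]; exact add_mem (hF p) (hG p)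
  zero_mem' p := by rw [Polynomial.coeff_zero]; exact zero_mem _
  smul_mem' c F hF p := by rw [Polynomial.coeff_smul]; exact Submodule.smul_mem _ c (hF p)

theorem C_mem_totalGr {d : ℤ} {r : R} (hr : r ∈ Rgr d) : Polynomial.C r ∈ totalGr d := by
  intro p
  rcases p with _ | p
  · simpa using hr
  · rw [Polynomial.coeff_C_succ]
    exact zero_mem _

theorem mulX_mem_totalGr {n : ℤ} {F : R[X]} (hF : F ∈ totalGr n) : mulX F ∈ totalGr (n + 1) := by
  intro p
  rcases p with _ | p
  · simp
  · rw [mulX_apply, Polynomial.coeff_X_mul,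
      show n + 1 - ((p + 1 : ℕ) : ℤ) = n - p by push_cast; ring]
    exact hF p

theorem extend_mem_totalGr {T : Module.End ℂ R} {d : ℤ}
    (hT : ∀ k : ℤ, ∀ r ∈ Rgr k, T r ∈ Rgr (k + d)) {n : ℤ} {F : R[X]} (hF : F ∈ totalGr n) :
    extend T F ∈ totalGr (n + d) := by
  intro p
  rw [coeff_extend, show n + d - p = n - p + d by ring]
  exact hT _ _ (hF p)

theorem leftMul_mem_totalGr (τ : ℂ) (x : g) {n : ℤ} {F : R[X]} (hF : F ∈ totalGr n) :
    leftMul τ x F ∈ totalGr (n + 1) := by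
  have h0 : extend (mulMom x) F ∈ totalGr (n + 1) :=
    extend_mem_totalGr (fun k r hr => mul_mem_Rgr x hr) hF
  have h1 : extend ((1 / 2 : ℂ) • hamR x) F ∈ totalGr (n + 0) :=
    extend_mem_totalGr (fun k r hr => by
      rw [add_zero]; exact Submodule.smul_mem _ _ (hamR_mem_Rgr x hr)) hF
  have h2 : extend (lam τ x) F ∈ totalGr (n + -1) :=
    extend_mem_totalGr (fun k r hr => lam_mem_Rgr τ x hr) hF
  have h1' := mulX_mem_totalGr h1
  have h2' := mulX_mem_totalGr (mulX_mem_totalGr h2)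
  rw [add_zero] at h1'
  rw [neg_add_cancel_right] at h2'
  exact add_mem (add_mem h0 h1') h2'

/-- If `a₀` sends `1` to `r`, then `leftMul τ x * a₀` sends `1` to `μ_x r` up to terms in `t` and
`t²` whose coefficients have degrees `k` and `k - 1`. Operators reaching those coefficients exist by
induction and are subtracted. The bound on total degree is carried along because it becomes the
grading axiom. -/
theorem exists_leftAlg_C (τ : ℂ) (k : ℕ) (r : R) (hr : r ∈ Rgr k) :
    ∃ a ∈ leftAlg τ, a 1 = Polynomial.C r ∧ ∀ n, ∀ G ∈ totalGr n, a G ∈ totalGr (n + k) := by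
  induction k using Nat.strong_induction_on generalizing r with
  | _ k ih =>
  rcases k with _ | k
  · rw [Rgr_natCast, pow_zero, Submodule.mem_one] at hr
    obtain ⟨c, rfl⟩ := hr
    refine ⟨algebraMap ℂ _ c, Subalgebra.algebraMap_mem _ c, ?_, fun n G hG => ?_⟩
    · rw [Module.algebraMap_end_apply, Algebra.algebraMap_eq_smul_one, ← Polynomial.C_1,
        Polynomial.smul_C]
    · rw [Module.algebraMap_end_apply, Nat.cast_zero, add_zero]
      exact Submodule.smul_mem _ _ hG
  · rw [Rgr_natCast, pow_succ'] at hr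
    induction hr using Submodule.mul_induction_on' with
    | mem_mul_mem y hy r hr =>
      obtain ⟨x, rfl⟩ := hy
      rw [← Rgr_natCast] at hr
      obtain ⟨a₀, ha₀, h₀, g₀⟩ := ih k k.lt_succ_self r hr
      obtain ⟨a₁, ha₁, h₁, g₁⟩ := ih k k.lt_succ_self ((1 / 2 : ℂ) • hamR x r)
        (Submodule.smul_mem _ _ (hamR_mem_Rgr x hr))
      -- For `k = 0` the coefficient lies in degree `-1`, hence is zero, and the zero operator
      -- serves.
      obtain ⟨a₂, ha₂, h₂, g₂⟩ : ∃ a ∈ leftAlg τ, a 1 = Polynomial.C (lam τ x r) ∧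
          ∀ n, ∀ G ∈ totalGr n, a G ∈ totalGr (n + (k - 1 : ℤ)) := by
        have hl := lam_mem_Rgr τ x hr
        rcases k with _ | k
        · rw [Rgr_of_neg (by simp), Submodule.mem_bot] at hl
          rw [hl]
          exact ⟨0, zero_mem _, by simp, fun n G _ => zero_mem _⟩
        · rw [show ((k + 1 : ℕ) : ℤ) - 1 = (k : ℕ) by push_cast; ring] at *
          exact ih k (by omega) _ hl
      refine ⟨leftMul τ x * a₀ - mulX * a₁ - mulX * (mulX * a₂), ?_, ?_, fun n G hG => ?_⟩
      · exact sub_mem (sub_mem (mul_mem (leftMul_mem τ x) ha₀) (mul_mem (mulX_mem_leftAlg τ) ha₁))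
          (mul_mem (mulX_mem_leftAlg τ) (mul_mem (mulX_mem_leftAlg τ) ha₂))
      · simp only [LinearMap.sub_apply, Module.End.mul_apply, h₀, h₁, h₂, leftMul_C, mulX_apply]
        ring
      · have e₀ := leftMul_mem_totalGr τ x (g₀ n G hG)
        have e₁ := mulX_mem_totalGr (g₁ n G hG)
        have e₂ := mulX_mem_totalGr (mulX_mem_totalGr (g₂ n G hG))
        rw [show n + (k - 1 : ℤ) + 1 + 1 = n + ((k + 1 : ℕ) : ℤ) by push_cast; ring] at e₂
        rw [add_assoc, ← Nat.cast_succ] at e₀ e₁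
        exact sub_mem (sub_mem e₀ e₁) e₂
    | add r _ r' _ h h' =>
      obtain ⟨a, ha, h1, g1⟩ := h
      obtain ⟨a', ha', h1', g1'⟩ := h'
      exact ⟨a + a', add_mem ha ha', by rw [LinearMap.add_apply, h1, h1', map_add],
        fun n G hG => add_mem (g1 n G hG) (g1' n G hG)⟩

theorem exists_leftAlg (τ : ℂ) (F : R[X]) : ∃ a ∈ leftAlg τ, a 1 = F := by
  have hC (r : R) : ∃ a ∈ leftAlg τ, a 1 = Polynomial.C r := by
    let M : Submodule ℂ R := ((leftAlg τ).toSubmodule.map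
      (LinearMap.applyₗ (1 : R[X]))).comap ((Polynomial.monomial 0).restrictScalars ℂ)
    refine eq_top_of_Rgr_le M (fun k r hr => ?_) r
    obtain ⟨a, ha, h1, -⟩ := exists_leftAlg_C τ k r hr
    exact ⟨a, ha, h1⟩
  induction F using Polynomial.induction_on' with
  | add F G hF hG =>
    obtain ⟨a, ha, rfl⟩ := hF
    obtain ⟨a', ha', rfl⟩ := hG
    exact ⟨a + a', add_mem ha ha', rfl⟩
  | monomial n r =>
    induction n with
    | zero => exact hC r
    | succ n ih =>
      obtain ⟨a, ha, h1⟩ := ih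
      exact ⟨mulX * a, mul_mem (mulX_mem_leftAlg τ) ha, by
        rw [Module.End.mul_apply, h1, mulX_apply, Polynomial.X_mul_monomial]⟩

/-- Conjugation by `t ↦ -t` changes the sign of `t` in `leftMul τ x`, which gives `rightMul τ x`. -/
theorem flip_mul_mem_rightAlg {τ : ℂ} {a : Module.End ℂ R[X]} (ha : a ∈ leftAlg τ) :
    flip * a * flip ∈ rightAlg τ := by
  have hX : flip * mulX * flip = (-1 : ℂ) • mulX := by
    rw [flip_mulX, smul_mul_assoc, mul_assoc, flip_mul_flip, mul_one]
  have hT (T : Module.End ℂ R) : flip * extend T * flip = extend T := by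
    rw [flip_extend, mul_assoc, flip_mul_flip, mul_one]
  have hm (a b : Module.End ℂ R[X]) : flip * (a * b) * flip =
      (flip * a * flip) * (flip * b * flip) := by
    calc flip * (a * b) * flip = flip * a * 1 * b * flip := by simp only [mul_assoc, one_mul]
      _ = _ := by rw [← flip_mul_flip]; simp only [mul_assoc]
  induction ha using Algebra.adjoin_induction with
  | mem a ha =>
    rcases ha with rfl | ⟨x, rfl⟩
    · rw [hX]
      exact Subalgebra.smul_mem _ (mulX_mem_rightAlg τ) _
    · have : flip * leftMul τ x * flip = rightMul τ x := by
        rw [leftMul, rightMul, mul_add, mul_add, add_mul, add_mul, hm, hm mulX, hm mulX, hT, hT, hT,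
          hX]
        simp only [smul_mul_assoc, mul_smul_comm, smul_smul]
        norm_num
        rfl
      rw [this]
      exact rightMul_mem τ x
  | algebraMap c =>
    rw [← Algebra.commutes, mul_assoc, flip_mul_flip, mul_one]
    exact Subalgebra.algebraMap_mem _ c
  | add a b _ _ h₁ h₂ => rw [mul_add, add_mul]; exact add_mem h₁ h₂
  | mul a b _ _ h₁ h₂ => rw [hm]; exact mul_mem h₁ h₂

theorem flip_one : flip 1 = 1 := by rw [← Polynomial.C_1, flip_C]

theorem flip_flip (F : R[X]) : flip (flip F) = F := DFunLike.congr_fun flip_mul_flip F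

theorem exists_rightAlg (τ : ℂ) (F : R[X]) : ∃ b ∈ rightAlg τ, b 1 = F := by
  obtain ⟨a, ha, h1⟩ := exists_leftAlg τ (flip F)
  refine ⟨_, flip_mul_mem_rightAlg ha, ?_⟩
  rw [Module.End.mul_apply, Module.End.mul_apply, flip_one, h1, flip_flip]

/-- The evaluation of the left multiplications at `1`. -/
def evalOne (τ : ℂ) : leftAlg τ →ₗ[ℂ] R[X] :=
  LinearMap.applyₗ (1 : R[X]) ∘ₗ (leftAlg τ).val.toLinearMap

/-- A left operator that kills `1` kills `b 1` for every right operator `b`, since they commute, and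
every element of `R[t]` has this form. -/
theorem evalOne_bijective (τ : ℂ) : Function.Bijective (evalOne τ) := by
  constructor
  · rw [injective_iff_map_eq_zero]
    intro a ha
    apply Subtype.ext
    ext F : 1
    obtain ⟨b, hb, rfl⟩ := exists_rightAlg τ F
    change a.1 1 = 0 at ha
    change (a.1 * b) 1 = 0
    rw [leftAlg_commute_rightAlg a.2 hb, Module.End.mul_apply, ha, map_zero]
  · intro F
    obtain ⟨a, ha, h1⟩ := exists_leftAlg τ F
    exact ⟨⟨a, ha⟩, h1⟩

/-! ### The star product with parameter `τ` and its axioms -/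

/-- The product on `R[t]` for which `leftMul` are the left multiplications. -/
def starMap (τ : ℂ) : R[X] →ₗ[ℂ] R[X] →ₗ[ℂ] R[X] :=
  (leftAlg τ).val.toLinearMap ∘ₗ (LinearEquiv.ofBijective _ (evalOne_bijective τ)).symm.toLinearMap

theorem starMap_left {τ : ℂ} {a : Module.End ℂ R[X]} (ha : a ∈ leftAlg τ) :
    starMap τ (a 1) = a := by
  have : (LinearEquiv.ofBijective _ (evalOne_bijective τ)).symm (a 1) = ⟨a, ha⟩ := by
    rw [LinearEquiv.symm_apply_eq]
    rfl
  change ((LinearEquiv.ofBijective _ (evalOne_bijective τ)).symm (a 1)).1 = a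
  rw [this]

theorem starMap_right {τ : ℂ} {b : Module.End ℂ R[X]} (hb : b ∈ rightAlg τ) (F : R[X]) :
    starMap τ F (b 1) = b F := by
  obtain ⟨a, ha, rfl⟩ := exists_leftAlg τ F
  rw [starMap_left ha, ← Module.End.mul_apply, ← Module.End.mul_apply,
    leftAlg_commute_rightAlg ha hb]

theorem starMap_mom (τ : ℂ) (x : g) (F : R[X]) :
    starMap τ (Polynomial.C (mom x)) F = leftMul τ x F := by
  rw [← leftMul_one τ x, starMap_left (leftMul_mem τ x)]

theorem starMap_mom_right (τ : ℂ) (x : g) (F : R[X]) :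
    starMap τ F (Polynomial.C (mom x)) = rightMul τ x F := by
  rw [← rightMul_one τ x, starMap_right (rightMul_mem τ x)]

theorem starMap_X_left (τ : ℂ) (F G : R[X]) :
    starMap τ (Polynomial.X * F) G = Polynomial.X * starMap τ F G := by
  obtain ⟨a, ha, rfl⟩ := exists_leftAlg τ F
  rw [← mulX_apply, ← Module.End.mul_apply, starMap_left (mul_mem (mulX_mem_leftAlg τ) ha),
    starMap_left ha]
  rfl

theorem starMap_X_right (τ : ℂ) (F G : R[X]) :
    starMap τ F (Polynomial.X * G) = Polynomial.X * starMap τ F G := by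
  obtain ⟨b, hb, rfl⟩ := exists_rightAlg τ G
  rw [starMap_right hb]
  exact starMap_right (mul_mem (mulX_mem_rightAlg τ) hb) F

theorem starMap_assoc (τ : ℂ) (F G H : R[X]) :
    starMap τ (starMap τ F G) H = starMap τ F (starMap τ G H) := by
  obtain ⟨a, ha, rfl⟩ := exists_leftAlg τ F
  obtain ⟨a', ha', rfl⟩ := exists_leftAlg τ G
  rw [starMap_left ha, starMap_left ha', ← Module.End.mul_apply, starMap_left (mul_mem ha ha'),
    Module.End.mul_apply]

/-- If `a` is left multiplication by `r`, its conjugate by `flip` is a right operator with the same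
value at `1`, hence right multiplication by `r`. -/
theorem starMap_flip (τ : ℂ) (r r' : R) : starMap τ (Polynomial.C r') (Polynomial.C r) =
    flip (starMap τ (Polynomial.C r) (Polynomial.C r')) := by
  obtain ⟨a, ha, h1⟩ := exists_leftAlg τ (Polynomial.C r)
  have hb : (flip * a * flip) 1 = Polynomial.C r := by
    rw [Module.End.mul_apply, Module.End.mul_apply, flip_one, h1, flip_C]
  conv_lhs => rw [← hb]
  rw [starMap_right (flip_mul_mem_rightAlg ha), ← h1, starMap_left ha, Module.End.mul_apply,
    Module.End.mul_apply, flip_C]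

theorem starMap_parity (τ : ℂ) (p : ℕ) (r r' : R) :
    (starMap τ (Polynomial.C r) (Polynomial.C r')).coeff p =
      (-1) ^ p * (starMap τ (Polynomial.C r') (Polynomial.C r)).coeff p := by
  rw [starMap_flip τ r' r, coeff_flip, Algebra.smul_def, map_pow, map_neg, map_one]

theorem starMap_graded (τ : ℂ) (p k l : ℕ) (r : R) (hr : r ∈ Rgr k) (r' : R) (hr' : r' ∈ Rgr l) :
    (starMap τ (Polynomial.C r) (Polynomial.C r')).coeff p ∈ Rgr ((k : ℤ) + l - p) := by
  obtain ⟨a, ha, h1, ha'⟩ := exists_leftAlg_C τ k r hr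
  rw [← h1, starMap_left ha, add_comm]
  exact ha' l _ (C_mem_totalGr hr') p

/-- A left multiplication is, up to first order in `t`, given by the product and the Poisson
bracket. -/
theorem leftAlg_first_order {τ : ℂ} {a : Module.End ℂ R[X]} (ha : a ∈ leftAlg τ) :
    ∃ r r' : R, ∀ F : R[X], (a F).coeff 0 = r * F.coeff 0 ∧
      rho ((a F).coeff 1) = rho r * rho (F.coeff 1) + rho r' * rho (F.coeff 0) +
        MvPolynomial.C (1 / 2) * ham (rho r) (rho (F.coeff 0)) := by
  induction ha using Algebra.adjoin_induction with
  | mem a ha =>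
    rcases ha with rfl | ⟨x, rfl⟩
    · exact ⟨0, 1, fun F => by simp [ham_apply]⟩
    · refine ⟨mom x, 0, fun F => ?_⟩
      simp [leftMul, Polynomial.coeff_X_mul, MvPolynomial.smul_eq_C_mul]
  | algebraMap c =>
    refine ⟨algebraMap ℂ R c, 0, fun F => ?_⟩
    simp [ham_apply, Algebra.smul_def]
  | add a b _ _ h₁ h₂ =>
    obtain ⟨r₁, r₁', h₁⟩ := h₁
    obtain ⟨r₂, r₂', h₂⟩ := h₂
    refine ⟨r₁ + r₂, r₁' + r₂', fun F => ⟨?_, ?_⟩⟩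
    · rw [LinearMap.add_apply, Polynomial.coeff_add, (h₁ F).1, (h₂ F).1, add_mul]
    · simp only [LinearMap.add_apply, Polynomial.coeff_add, map_add, (h₁ F).2, (h₂ F).2, ham_apply]
      ring
  | mul a b _ _ h₁ h₂ =>
    obtain ⟨r₁, r₁', h₁⟩ := h₁
    obtain ⟨r₂, r₂', h₂⟩ := h₂
    obtain ⟨q, hq⟩ : ∃ q, rho q = ham (rho r₁) (rho r₂) := by
      obtain ⟨a₁, rfl⟩ := proj_surjective r₁
      obtain ⟨a₂, rfl⟩ := proj_surjective r₂
      exact ⟨proj (poisson a₁ a₂), rhoS_poisson a₁ a₂⟩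
    -- The term `q = {r₁, r₂}` comes from the Leibniz rule for `{r₁, r₂ F₀}`, with `F₀` the constant
    -- coefficient of `F`.
    refine ⟨r₁ * r₂, r₁ * r₂' + r₁' * r₂ + (1 / 2 : ℂ) • q, fun F => ⟨?_, ?_⟩⟩
    · rw [Module.End.mul_apply, (h₁ _).1, (h₂ F).1, mul_assoc]
    · simp only [Module.End.mul_apply, (h₁ _).2, (h₂ F).2, (h₂ F).1, map_add, map_mul, map_smul, hq,
        MvPolynomial.smul_eq_C_mul, ham_apply, Derivation.leibniz, smul_eq_mul]
      ring

theorem starMap_coeff_zero (τ : ℂ) (r r' : R) :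
    (starMap τ (Polynomial.C r) (Polynomial.C r')).coeff 0 = r * r' := by
  obtain ⟨a, ha, h1⟩ := exists_leftAlg τ (Polynomial.C r)
  obtain ⟨r₁, r₁', h₁⟩ := leftAlg_first_order ha
  have h0 := (h₁ 1).1
  rw [h1] at h0
  simp only [Polynomial.coeff_C_zero, Polynomial.coeff_one_zero, mul_one] at h0
  rw [← h1, starMap_left ha, (h₁ _).1, Polynomial.coeff_C_zero, h0]

theorem rho_starMap_coeff_one (τ : ℂ) (r r' : R) :
    rho ((starMap τ (Polynomial.C r) (Polynomial.C r')).coeff 1) =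
      MvPolynomial.C (1 / 2) * ham (rho r) (rho r') := by
  obtain ⟨a, ha, h1⟩ := exists_leftAlg τ (Polynomial.C r)
  obtain ⟨r₁, r₁', h₁⟩ := leftAlg_first_order ha
  -- The value of `a` at `1` is the constant `r`, which forces `r₁ = r` and `rho r₁' = 0`.
  have h0 := (h₁ 1).1
  have h0' := (h₁ 1).2
  rw [h1] at h0 h0'
  simp [Polynomial.coeff_one, Polynomial.coeff_C] at h0 h0'
  rw [← h1, starMap_left ha, (h₁ _).2, ← h0, ← h0']
  simp [Polynomial.coeff_C]

theorem starMap_coeff_one (τ : ℂ) (a b : S) :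
    (starMap τ (Polynomial.C (proj a)) (Polynomial.C (proj b))).coeff 1 -
      (starMap τ (Polynomial.C (proj b)) (Polynomial.C (proj a))).coeff 1 =
        proj (poisson a b) := by
  apply rho_injective
  rw [map_sub, rho_starMap_coeff_one, rho_starMap_coeff_one, rho_proj, rho_proj, rho_proj,
    rhoS_poisson, ham_apply, ham_apply]
  have : (MvPolynomial.C (1 / 2 : ℂ) : P) * 2 = 1 := by
    rw [show (2 : P) = MvPolynomial.C 2 from (map_ofNat _ 2).symm, ← map_mul]
    norm_num
  linear_combination (MvPolynomial.C (-1 / 2 : ℂ) *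
    (du (rhoS a) * dv (rhoS b) - dv (rhoS a) * du (rhoS b))) * this

/-- The star product with parameter `τ`. -/
def starProduct (τ : ℂ) : StarProduct where
  star := starMap τ
  X_star := starMap_X_left τ
  star_X := starMap_X_right τ
  assoc := starMap_assoc τ
  coeff_zero := starMap_coeff_zero τ
  coeff_one := starMap_coeff_one τ
  parity := starMap_parity τ
  graded := starMap_graded τ

theorem starProduct_isEquivariant (τ : ℂ) : (starProduct τ).IsEquivariant := by
  intro x a
  change starMap τ _ _ - starMap τ _ _ = _
  rw [starMap_mom, starMap_mom_right, ← hamR_proj, ← extend_C]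
  have : leftMul τ x - rightMul τ x = mulX * extend (hamR x) := by
    have h2 : extend (hamR x) = extend ((1 / 2 : ℂ) • hamR x) + extend ((1 / 2 : ℂ) • hamR x) := by
      rw [← extend_add, ← add_smul]
      norm_num
    rw [h2, leftMul, rightMul, mul_add]
    abel
  exact DFunLike.congr_fun this (Polynomial.C (proj a))

/-! ### The Casimir value of the constructed family -/

/-- The value of the Casimir element in the algebra of a star product. -/
def casimir (s : StarProduct) : R :=
  s.circ (mom h) (mom h) - (2 : ℂ) • mom h + (4 : ℂ) • s.circ (mom e) (mom f)

/-- The quadratic terms cancel by the equation `h² + 4ef = 0` of the cone, and the linear ones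
because `⁅e, f⁆ = h`. What remains is `coef τ 2 = (4 - τ)/48` times `-4 + 4 · (-2) = -12`. -/
theorem casimir_starProduct (τ : ℂ) :
    casimir (starProduct τ) = algebraMap ℂ R (τ / 4 - 1) := by
  have hc (x y : g) : (starProduct τ).circ (mom x) (mom y) =
      mom x * mom y + (1 / 2 : ℂ) • mom ⁅x, y⁆ + lam τ x (mom y) := by
    change (starMap τ _ _).eval 1 = _
    rw [starMap_mom, leftMul_C, hamR_mom]
    simp
  have hl (x y : g) : rho (lam τ x (mom y)) = MvPolynomial.C (coef τ 2) * diffTwo x (quad y) := by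
    rw [rho_lam τ x (k := 1) (mom_mem_Rgr y), rho_mom]
  have h2 : coef τ 2 = (4 - τ) / 48 := by
    rw [coef]
    norm_num
  apply rho_injective
  rw [casimir, hc, hc, lie_self, lie_e_f]
  simp only [map_add, map_sub, map_smul, map_mul, rho_mom, hl, quad_e, quad_f, quad_h, map_zero,
    smul_zero, AlgHom.commutes, MvPolynomial.algebraMap_eq, h2, MvPolynomial.smul_eq_C_mul]
  have c4 : (MvPolynomial.C 4 : P) = 4 := map_ofNat _ 4
  have c2 : (MvPolynomial.C 2 : P) = 2 := map_ofNat _ 2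
  have d1 : diffTwo h (-(2 * u * v)) = -4 := by
    simp [diffTwo_apply, h, Derivation.leibniz]
    norm_num
  have d2 : diffTwo e (u ^ 2) = -2 := by
    simp [diffTwo_apply, e_eq, Derivation.leibniz, Derivation.leibniz_pow]
  have c1 : (MvPolynomial.C (1 / 2 : ℂ) : P) * 2 = 1 := by
    rw [← c2, ← map_mul]
    norm_num
  have cτ : (MvPolynomial.C (τ / 4 - 1) : P) = -12 * MvPolynomial.C ((4 - τ) / 48) := by
    rw [show (-12 : P) = MvPolynomial.C (-12) by rw [map_neg, map_ofNat], ← map_mul]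
    congr 1
    ring
  rw [map_sub] at cτ
  rw [d1, d2, c4, c2]
  linear_combination (-4 * u * v) * c1 - cτ

/-! ### The algebra of a star product -/

namespace StarProduct

/-- The product `∘` as a bilinear map. -/
def circL (s : StarProduct) : R →ₗ[ℂ] Module.End ℂ R :=
  (s.star.compl₁₂ ((Polynomial.monomial 0).restrictScalars ℂ : R →ₗ[ℂ] R[X])
    ((Polynomial.monomial 0).restrictScalars ℂ)).compr₂ ((Polynomial.leval 1).restrictScalars ℂ)

theorem circL_apply (s : StarProduct) (r r' : R) : s.circL r r' = s.circ r r' := rfl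

theorem eval_star (s : StarProduct) (F G : R[X]) :
    (s.star F G).eval 1 = s.circ (F.eval 1) (G.eval 1) := by
  have hX (F : R[X]) (n : ℕ) (r : R) :
      (s.star F (Polynomial.monomial n r)).eval 1 = (s.star F (Polynomial.C r)).eval 1 := by
    induction n with
    | zero => rfl
    | succ n ih => rw [← Polynomial.X_mul_monomial, s.star_X]; simpa using ih
  have hX' (G : R[X]) (n : ℕ) (r : R) :
      (s.star (Polynomial.monomial n r) G).eval 1 = (s.star (Polynomial.C r) G).eval 1 := by
    induction n with
    | zero => rfl
    | succ n ih => rw [← Polynomial.X_mul_monomial, s.X_star]; simpa using ih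
  induction F using Polynomial.induction_on' with
  | add F F' hF hF' =>
    rw [map_add, LinearMap.add_apply, Polynomial.eval_add, Polynomial.eval_add, hF, hF']
    simp only [← circL_apply, map_add, LinearMap.add_apply]
  | monomial n r =>
    rw [hX']
    induction G using Polynomial.induction_on' with
    | add G G' hG hG' =>
      rw [map_add, Polynomial.eval_add, Polynomial.eval_add, hG, hG']
      simp only [← circL_apply, map_add]
    | monomial m r' =>
      rw [hX]
      simp [circ]

theorem circ_assoc (s : StarProduct) (a b c : R) :
    s.circ (s.circ a b) c = s.circ a (s.circ b c) := by
  have h1 := congrArg (Polynomial.eval 1)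
    (s.assoc (Polynomial.C a) (Polynomial.C b) (Polynomial.C c))
  rw [eval_star, eval_star, eval_star, eval_star] at h1
  simpa using h1

theorem star_coeff_zero (s : StarProduct) (F G : R[X]) :
    (s.star F G).coeff 0 = F.coeff 0 * G.coeff 0 := by
  conv_lhs => rw [← Polynomial.X_mul_divX_add F, ← Polynomial.X_mul_divX_add G]
  rw [map_add, map_add, LinearMap.add_apply, s.X_star, s.star_X, LinearMap.add_apply, s.X_star]
  simp [s.coeff_zero, s.star_X]

/-- The axioms do not say that `1` is a unit. The grading puts the higher coefficients of `1 ⋆ 1` in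
negative degrees, so `1` is idempotent; with injectivity of `· ⋆ 1` and the parity axiom this makes
it a unit. -/
theorem one_star_one (s : StarProduct) : s.star (Polynomial.C 1) (Polynomial.C 1) = 1 := by
  ext p
  rcases p with _ | p
  · rw [s.coeff_zero]
    simp
  · have := s.graded (p + 1) 0 0 1 one_mem_Rgr 1 one_mem_Rgr
    rw [Rgr_of_neg (by push_cast; omega), Submodule.mem_bot] at this
    rw [this, Polynomial.coeff_one, if_neg (Nat.succ_ne_zero p)]

/-- Modulo `t` the map `F ↦ F ⋆ 1` is the identity, so an `F` it kills is divisible by `t`, and one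
divides and repeats. -/
theorem eq_zero_of_star_one (s : StarProduct) {F : R[X]} (hF : s.star F (Polynomial.C 1) = 0) :
    F = 0 := by
  ext p
  induction p generalizing F with
  | zero =>
    have := s.star_coeff_zero F (Polynomial.C 1)
    rw [hF] at this
    simpa using this.symm
  | succ p ih =>
    have h0 : F.coeff 0 = 0 := by
      have := s.star_coeff_zero F (Polynomial.C 1)
      rw [hF] at this
      simpa using this.symm
    have h1 : F = Polynomial.X * F.divX := by
      conv_lhs => rw [← Polynomial.X_mul_divX_add F, h0, map_zero, add_zero]
    have h2 : s.star F.divX (Polynomial.C 1) = 0 := by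
      rw [h1, s.X_star] at hF
      ext n
      have := congrArg (fun G => Polynomial.coeff G (n + 1)) hF
      simpa [Polynomial.coeff_X_mul] using this
    have := ih h2
    rwa [Polynomial.coeff_divX] at this

theorem star_one (s : StarProduct) (F : R[X]) : s.star F (Polynomial.C 1) = F := by
  refine sub_eq_zero.1 (s.eq_zero_of_star_one ?_)
  rw [map_sub, LinearMap.sub_apply, s.assoc, one_star_one, ← Polynomial.C_1, sub_self]

theorem circ_one (s : StarProduct) (r : R) : s.circ r 1 = r := by
  rw [circ, star_one, Polynomial.eval_C]

theorem one_circ (s : StarProduct) (r : R) : s.circ 1 r = r := by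
  have : s.star (Polynomial.C 1) (Polynomial.C r) = Polynomial.C r := by
    ext p
    rw [s.parity, star_one]
    rcases p with _ | p
    · simp
    · simp
  rw [circ, this, Polynomial.eval_C]

theorem circ_sub_circ {s : StarProduct} (hs : s.IsEquivariant) (x : g) (r : R) :
    s.circ (mom x) r - s.circ r (mom x) = hamR x r := by
  obtain ⟨a, rfl⟩ := proj_surjective r
  have := congrArg (Polynomial.eval 1) (hs x a)
  rw [Polynomial.eval_sub] at this
  rw [circ, circ, this, hamR_proj]
  simp

/-- The action of `𝔤` on `R` by left multiplications. -/
def leftLie {s : StarProduct} (hs : s.IsEquivariant) : g →ₗ⁅ℂ⁆ Module.End ℂ R where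
  toLinearMap := s.circL ∘ₗ mom
  map_lie' {x y} := by
    ext r
    change s.circ (mom ⁅x, y⁆) r = s.circ (mom x) (s.circ (mom y) r) -
      s.circ (mom y) (s.circ (mom x) r)
    rw [← circ_assoc, ← circ_assoc, ← hamR_mom, ← circ_sub_circ hs]
    simp only [← circL_apply, map_sub, LinearMap.sub_apply]

/-- The action of `U(𝔤)` on `R` by left multiplications. -/
def leftRep {s : StarProduct} (hs : s.IsEquivariant) : U →ₐ[ℂ] Module.End ℂ R :=
  UniversalEnvelopingAlgebra.lift ℂ (leftLie hs)

theorem leftRep_ι {s : StarProduct} (hs : s.IsEquivariant) (x : g) :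
    leftRep hs (UniversalEnvelopingAlgebra.ι ℂ x) = s.circL (mom x) :=
  UniversalEnvelopingAlgebra.lift_ι_apply ℂ (leftLie hs) x

end StarProduct

theorem U_induction (A : Subalgebra ℂ U) (hA : ∀ x : g, UniversalEnvelopingAlgebra.ι ℂ x ∈ A)
    (w : U) : w ∈ A := by
  let φ : g →ₗ⁅ℂ⁆ A :=
    { toFun := fun x => ⟨UniversalEnvelopingAlgebra.ι ℂ x, hA x⟩
      map_add' := fun x y => Subtype.ext (map_add _ x y)
      map_smul' := fun c x => Subtype.ext (map_smul _ c x)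
      map_lie' := fun {x y} => Subtype.ext (LieHom.map_lie _ x y) }
  have h1 : A.val.comp (UniversalEnvelopingAlgebra.lift ℂ φ) = AlgHom.id ℂ U := by
    apply UniversalEnvelopingAlgebra.hom_ext
    ext x
    simp [φ]
  have h2 := DFunLike.congr_fun h1 w
  rw [AlgHom.id_apply] at h2
  rw [← h2]
  exact (UniversalEnvelopingAlgebra.lift ℂ φ w).2

namespace StarProduct

variable {s : StarProduct} (hs : s.IsEquivariant)

/-- The homomorphism from `U(𝔤)` to the algebra of a star product. -/
def psi : U →ₗ[ℂ] R := LinearMap.applyₗ (1 : R) ∘ₗ (leftRep hs).toLinearMap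

theorem psi_apply (w : U) : psi hs w = leftRep hs w 1 := rfl

theorem leftRep_eq (w : U) : leftRep hs w = s.circL (psi hs w) := by
  have h1 : s.circL 1 = 1 := by
    ext r
    exact s.one_circ r
  have hm (a b : R) : s.circL a * s.circL b = s.circL (s.circ a b) := by
    ext r
    exact (s.circ_assoc a b r).symm
  let A : Subalgebra ℂ U :=
    { carrier := {w | ∃ r, leftRep hs w = s.circL r}
      mul_mem' := by
        rintro a b ⟨r, hr⟩ ⟨r', hr'⟩
        exact ⟨s.circ r r', by rw [map_mul, hr, hr', hm]⟩
      add_mem' := by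
        rintro a b ⟨r, hr⟩ ⟨r', hr'⟩
        exact ⟨r + r', by rw [map_add, map_add, hr, hr']⟩
      algebraMap_mem' := fun c => ⟨c • 1, by
        rw [AlgHom.commutes, map_smul, h1, Algebra.algebraMap_eq_smul_one]⟩ }
  obtain ⟨r, hr⟩ := U_induction A (fun x => ⟨mom x, leftRep_ι hs x⟩) w
  rw [hr, psi_apply, hr, circL_apply, circ_one]

theorem psi_one : psi hs 1 = 1 := by
  rw [psi_apply, map_one (leftRep hs)]
  rfl

theorem psi_ι (x : g) : psi hs (UniversalEnvelopingAlgebra.ι ℂ x) = mom x := by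
  rw [psi_apply, leftRep_ι, circL_apply, circ_one]

theorem psi_mul (w w' : U) : psi hs (w * w') = s.circ (psi hs w) (psi hs w') := by
  rw [psi_apply, map_mul, Module.End.mul_apply, leftRep_eq, circL_apply, ← psi_apply]

/-- This carries equivariance from `⋆` to `psi`: the adjoint action on `U` corresponds to the
Hamiltonian action on `R`, which is independent of the star product. -/
theorem psi_lie (x : g) (w : U) : psi hs (UniversalEnvelopingAlgebra.ι ℂ x * w -
    w * UniversalEnvelopingAlgebra.ι ℂ x) = hamR x (psi hs w) := by
  rw [map_sub, psi_mul, psi_mul, psi_ι, circ_sub_circ hs]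

theorem psi_eq_of_hom {Ψ : U →ₗ[ℂ] R} (h1 : Ψ 1 = 1)
    (hm : ∀ w w', Ψ (w * w') = s.circ (Ψ w) (Ψ w'))
    (hι : ∀ x : g, Ψ (UniversalEnvelopingAlgebra.ι ℂ x) = mom x) (w : U) : Ψ w = psi hs w := by
  let A : Subalgebra ℂ U :=
    { carrier := {w | Ψ w = psi hs w}
      mul_mem' := fun {a b} ha hb => by
        change Ψ (a * b) = psi hs (a * b)
        rw [hm, psi_mul, show Ψ a = psi hs a from ha, show Ψ b = psi hs b from hb]
      add_mem' := fun {a b} ha hb => by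
        change Ψ (a + b) = psi hs (a + b)
        rw [map_add, map_add, show Ψ a = psi hs a from ha, show Ψ b = psi hs b from hb]
      algebraMap_mem' := fun c => by
        change Ψ (algebraMap ℂ U c) = psi hs (algebraMap ℂ U c)
        rw [Algebra.algebraMap_eq_smul_one, map_smul, map_smul, h1, psi_one] }
  exact U_induction A (fun x => (hι x).trans (psi_ι hs x).symm) w

end StarProduct

/-! ### Leading terms -/

/-- The elements of `R` of degree less than `n` in the plane. -/
def lowerFil (n : ℕ) : Submodule ℂ R where
  carrier := {r | ∀ m : Fin 2 →₀ ℕ, n ≤ m.degree → (rho r).coeff m = 0}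
  add_mem' hr hr' m hm := by rw [map_add, MvPolynomial.coeff_add, hr m hm, hr' m hm, add_zero]
  zero_mem' m _ := by rw [map_zero, MvPolynomial.coeff_zero]
  smul_mem' c r hr m hm := by rw [map_smul, MvPolynomial.coeff_smul, hr m hm, smul_zero]

theorem lowerFil_mono {n n' : ℕ} (hn : n ≤ n') : lowerFil n ≤ lowerFil n' :=
  fun _ hr m hm => hr m (hn.trans hm)

theorem Rgr_le_lowerFil {d : ℤ} {n : ℕ} (hd : 2 * d < n) : Rgr d ≤ lowerFil n := by
  rcases lt_or_ge d 0 with h0 | h0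
  · rw [Rgr_of_neg h0]
    exact bot_le
  · lift d to ℕ using h0
    intro r hr m hm
    apply ((mem_Rgr_iff d r).1 hr).coeff_eq_zero
    omega

theorem mom_mul_mem_lowerFil (x : g) {n : ℕ} {r : R} (hr : r ∈ lowerFil n) :
    mom x * r ∈ lowerFil (n + 2) := by
  refine mem_of_monomials ((lowerFil (n + 2)).comap (mulMom x)) r fun m hm r' hr' => ?_
  obtain ⟨k, hk⟩ := even_iff_two_dvd.1 (even_degree_of_mem_support hm)
  have hn : m.degree < n := by
    by_contra! h
    exact MvPolynomial.mem_support_iff.1 hm (hr m h)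
  have hr'' : r' ∈ Rgr k := by
    rw [mem_Rgr_iff, hr']
    exact MvPolynomial.isHomogeneous_monomial 1 hk
  exact Rgr_le_lowerFil (by omega) (mul_mem_Rgr x hr'')

theorem circ_sub_mul_mem_lowerFil (s : StarProduct) (x : g) {n : ℕ} {r : R} (hr : r ∈ lowerFil n) :
    s.circ (mom x) r - mom x * r ∈ lowerFil n := by
  refine mem_of_monomials ((lowerFil n).comap (s.circL (mom x) - mulMom x)) r fun m hm r' hr' => ?_
  obtain ⟨k, hk⟩ := even_iff_two_dvd.1 (even_degree_of_mem_support hm)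
  have hn : m.degree < n := by
    by_contra! h
    exact MvPolynomial.mem_support_iff.1 hm (hr m h)
  have hr'' : r' ∈ Rgr k := by
    rw [mem_Rgr_iff, hr']
    exact MvPolynomial.isHomogeneous_monomial 1 hk
  change s.circ (mom x) r' - mom x * r' ∈ lowerFil n
  rw [StarProduct.circ, Polynomial.eval_eq_sum_range, Finset.sum_range_succ', s.coeff_zero, pow_zero,
    mul_one, add_sub_cancel_right]
  refine sum_mem fun p _ => ?_
  rw [one_pow, mul_one]
  refine Rgr_le_lowerFil ?_ (s.graded (p + 1) 1 k _ (mom_mem_Rgr x) _ hr'')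
  push_cast
  omega

/-- The `p`-th coefficient of `⋆` lowers the degree by `p`, so a word and the commutative product of
its letters have the same leading part. The index of `lowerFil` is the degree in the plane, twice
the degree in `R`. -/
theorem psi_prod_sub_mem {s : StarProduct} (hs : s.IsEquivariant) (l : List g) :
    StarProduct.psi hs (l.map (UniversalEnvelopingAlgebra.ι ℂ)).prod - (l.map mom).prod ∈
        lowerFil (2 * l.length) ∧ (l.map mom).prod ∈ Rgr l.length := by
  induction l with
  | nil => simp [StarProduct.psi_one, one_mem_Rgr]
  | cons x l ih =>
    obtain ⟨h1, h2⟩ := ih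
    simp only [List.map_cons, List.prod_cons, List.length_cons]
    refine ⟨?_, ?_⟩
    · rw [StarProduct.psi_mul, StarProduct.psi_ι]
      set w := StarProduct.psi hs (l.map (UniversalEnvelopingAlgebra.ι ℂ)).prod
      have h3 : w ∈ lowerFil (2 * l.length + 1) := by
        rw [← sub_add_cancel w]
        exact add_mem (lowerFil_mono (Nat.le_succ _) h1) (Rgr_le_lowerFil (by omega) h2)
      have h4 := circ_sub_mul_mem_lowerFil s x h3
      have h5 := mom_mul_mem_lowerFil x h1
      have h6 := add_mem (lowerFil_mono (show 2 * l.length + 1 ≤ 2 * (l.length + 1) by omega) h4) h5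
      convert h6 using 1
      ring
    · rw [Nat.cast_succ]
      exact mul_mem_Rgr x h2

/-! ### A spanning set modulo the Casimir element -/

section Span

variable {Q : Type*} [Ring Q] [Algebra ℂ Q] {E H F : Q}

theorem mul_pow_of_weight (hHE : H * E = E * H + (2 : ℂ) • E) (i : ℕ) :
    H * E ^ i = E ^ i * H + (2 * i : ℂ) • E ^ i := by
  induction i with
  | zero => simp
  | succ i ih =>
    rw [pow_succ, ← mul_assoc, ih, add_mul, mul_assoc, hHE, mul_add, smul_mul_assoc, mul_smul_comm,
      ← mul_assoc, add_assoc, ← add_smul]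
    push_cast
    ring_nf

theorem lowering_mul_pow (hHE : H * E = E * H + (2 : ℂ) • E) (hFE : F * E = E * F - H) (i : ℕ) :
    F * E ^ (i + 1) = E ^ (i + 1) * F - (i + 1 : ℂ) • (E ^ i * H) -
      ((i + 1) * i : ℂ) • E ^ i := by
  induction i with
  | zero => simp [hFE]
  | succ i ih =>
    rw [pow_succ E (i + 1), ← mul_assoc, ih, sub_mul, sub_mul, mul_assoc, hFE, smul_mul_assoc,
      smul_mul_assoc, mul_assoc (E ^ i), hHE, mul_sub, mul_add, mul_smul_comm, ← pow_succ,
      ← mul_assoc, ← mul_assoc, ← pow_succ, ← pow_succ]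
    push_cast
    module

/-- The span of the ordered monomials that are at most linear in `H`. -/
def wordSpan (E H F : Q) : Submodule ℂ Q :=
  Submodule.span ℂ (Set.range fun d : ℕ × Fin 2 × ℕ => E ^ d.1 * H ^ (d.2.1 : ℕ) * F ^ d.2.2)

theorem word_mem (E H F : Q) (i j : ℕ) : E ^ i * F ^ j ∈ wordSpan E H F :=
  Submodule.subset_span ⟨(i, 0, j), by simp⟩

theorem word_mem' (E H F : Q) (i j : ℕ) : E ^ i * H * F ^ j ∈ wordSpan E H F :=
  Submodule.subset_span ⟨(i, 1, j), by simp⟩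

theorem mem_wordSpan_of_mul {E H F z : Q} {T : Q →ₗ[ℂ] Q}
    (h0 : ∀ i j : ℕ, T (E ^ i * F ^ j) ∈ wordSpan E H F)
    (h1 : ∀ i j : ℕ, T (E ^ i * H * F ^ j) ∈ wordSpan E H F)
    (hz : z ∈ wordSpan E H F) : T z ∈ wordSpan E H F := by
  have : wordSpan E H F ≤ (wordSpan E H F).comap T := by
    refine Submodule.span_le.2 ?_
    rintro _ ⟨⟨i, n, j⟩, rfl⟩
    fin_cases n
    · simpa using h0 i j
    · simpa using h1 i j
  exact this hz

variable {c : ℂ}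

/-- Moving a letter into place uses the commutation relations only; the one word outside the span
that arises contains `H²`, which `hc` replaces. -/
theorem mul_mem_wordSpan (hHE : H * E = E * H + (2 : ℂ) • E) (hFE : F * E = E * F - H)
    (hFH : F * H = H * F + (2 : ℂ) • F)
    (hc : H * H = c • 1 + (2 : ℂ) • H - (4 : ℂ) • (E * F)) {z : Q} (hz : z ∈ wordSpan E H F) :
    E * z ∈ wordSpan E H F ∧ H * z ∈ wordSpan E H F ∧ F * z ∈ wordSpan E H F := by
  have h2 (i j : ℕ) : E ^ i * H * H * F ^ j ∈ wordSpan E H F := by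
    have : E ^ i * H * H * F ^ j = c • (E ^ i * F ^ j) + (2 : ℂ) • (E ^ i * H * F ^ j) -
        (4 : ℂ) • (E ^ (i + 1) * F ^ (j + 1)) := by
      rw [mul_assoc (E ^ i), hc, pow_succ, pow_succ']
      simp only [mul_add, mul_sub, add_mul, sub_mul, mul_smul_comm, smul_mul_assoc, mul_one,
        mul_assoc]
    rw [this]
    exact sub_mem (add_mem (Submodule.smul_mem _ _ (word_mem E H F i j))
      (Submodule.smul_mem _ _ (word_mem' E H F i j)))
      (Submodule.smul_mem _ _ (word_mem E H F (i + 1) (j + 1)))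
  refine ⟨?_, ?_, ?_⟩
  · refine mem_wordSpan_of_mul (T := LinearMap.mulLeft ℂ E) (fun i j => ?_) (fun i j => ?_) hz
    · rw [LinearMap.mulLeft_apply, ← mul_assoc, ← pow_succ']
      exact word_mem E H F (i + 1) j
    · rw [LinearMap.mulLeft_apply, ← mul_assoc, ← mul_assoc, ← pow_succ']
      exact word_mem' E H F (i + 1) j
  · refine mem_wordSpan_of_mul (T := LinearMap.mulLeft ℂ H) (fun i j => ?_) (fun i j => ?_) hz
    · rw [LinearMap.mulLeft_apply, ← mul_assoc, mul_pow_of_weight hHE, add_mul, smul_mul_assoc]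
      exact add_mem (word_mem' E H F i j) (Submodule.smul_mem _ _ (word_mem E H F i j))
    · rw [LinearMap.mulLeft_apply, ← mul_assoc, ← mul_assoc, mul_pow_of_weight hHE, add_mul, add_mul,
        smul_mul_assoc, smul_mul_assoc]
      exact add_mem (h2 i j) (Submodule.smul_mem _ _ (word_mem' E H F i j))
  · refine mem_wordSpan_of_mul (T := LinearMap.mulLeft ℂ F) (fun i j => ?_) (fun i j => ?_) hz
    · rw [LinearMap.mulLeft_apply, ← mul_assoc]
      rcases i with _ | i
      · rw [pow_zero, mul_one, ← pow_succ', ← one_mul (F ^ (j + 1)), ← pow_zero E]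
        exact word_mem E H F 0 (j + 1)
      · rw [lowering_mul_pow hHE hFE, sub_mul, sub_mul, mul_assoc, ← pow_succ', smul_mul_assoc,
          smul_mul_assoc]
        exact sub_mem (sub_mem (word_mem E H F (i + 1) (j + 1))
          (Submodule.smul_mem _ _ (word_mem' E H F i j)))
          (Submodule.smul_mem _ _ (word_mem E H F i j))
    · have h3 (i : ℕ) : E ^ i * F * H * F ^ j ∈ wordSpan E H F := by
        rw [mul_assoc (E ^ i), hFH, mul_add, add_mul, mul_smul_comm, smul_mul_assoc, ← mul_assoc,
          mul_assoc _ F, mul_assoc _ F, ← pow_succ']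
        exact add_mem (word_mem' E H F i (j + 1))
          (Submodule.smul_mem _ _ (word_mem E H F i (j + 1)))
      rw [LinearMap.mulLeft_apply, ← mul_assoc, ← mul_assoc]
      rcases i with _ | i
      · have := h3 0
        rw [pow_zero, one_mul] at this
        rwa [pow_zero, mul_one]
      · rw [lowering_mul_pow hHE hFE, sub_mul, sub_mul, sub_mul, sub_mul, smul_mul_assoc,
          smul_mul_assoc, smul_mul_assoc, smul_mul_assoc]
        exact sub_mem (sub_mem (h3 (i + 1)) (Submodule.smul_mem _ _ (h2 i j)))
          (Submodule.smul_mem _ _ (word_mem' E H F i j))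

end Span

/-- The image of `e` in `U(𝔤)`. -/
def eU : U := UniversalEnvelopingAlgebra.ι ℂ e

/-- The image of `h` in `U(𝔤)`. -/
def hU : U := UniversalEnvelopingAlgebra.ι ℂ h

/-- The image of `f` in `U(𝔤)`. -/
def fU : U := UniversalEnvelopingAlgebra.ι ℂ f

theorem hU_mul_eU : hU * eU = eU * hU + (2 : ℂ) • eU := by
  have := LieHom.map_lie (UniversalEnvelopingAlgebra.ι ℂ) h e
  rw [lie_h_e, map_smul, LieRing.of_associative_ring_bracket] at this
  exact eq_add_of_sub_eq' this.symm

theorem fU_mul_eU : fU * eU = eU * fU - hU := by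
  have := LieHom.map_lie (UniversalEnvelopingAlgebra.ι ℂ) e f
  rw [lie_e_f, LieRing.of_associative_ring_bracket] at this
  exact (sub_eq_of_eq_add (eq_add_of_sub_eq this.symm |>.trans (add_comm _ _))).symm

theorem fU_mul_hU : fU * hU = hU * fU + (2 : ℂ) • fU := by
  have := LieHom.map_lie (UniversalEnvelopingAlgebra.ι ℂ) h f
  rw [lie_h_f, map_smul, LieRing.of_associative_ring_bracket, neg_smul] at this
  have h2 : hU * fU = fU * hU + -((2 : ℂ) • fU) := eq_add_of_sub_eq' this.symm
  rw [h2, neg_add_cancel_right]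

/-- The Casimir element of `U(𝔤)`. -/
def casU : U := hU * hU - (2 : ℂ) • hU + (4 : ℂ) • (eU * fU)

/-- The ordered monomials of `U(𝔤)` that are at most linear in `h`. -/
def word (d : ℕ × Fin 2 × ℕ) : U := eU ^ d.1 * hU ^ (d.2.1 : ℕ) * fU ^ d.2.2

theorem map_mem_span_word {Q : Type*} [Ring Q] [Algebra ℂ Q] (Θ : U →ₐ[ℂ] Q) {c : ℂ}
    (hc : Θ casU = algebraMap ℂ Q c) (w : U) :
    Θ w ∈ Submodule.span ℂ (Set.range fun d => Θ (word d)) := by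
  have hspan : Submodule.span ℂ (Set.range fun d => Θ (word d)) =
      wordSpan (Θ eU) (Θ hU) (Θ fU) := by
    simp only [word, map_mul, map_pow, wordSpan]
  rw [hspan]
  have key {z : Q} (hz : z ∈ wordSpan (Θ eU) (Θ hU) (Θ fU)) :=
    mul_mem_wordSpan (c := c) (E := Θ eU) (H := Θ hU) (F := Θ fU)
    (by rw [← map_mul, hU_mul_eU, map_add, map_mul, map_smul])
    (by rw [← map_mul, fU_mul_eU, map_sub, map_mul])
    (by rw [← map_mul, fU_mul_hU, map_add, map_mul, map_smul])
    (by
      rw [← Algebra.algebraMap_eq_smul_one, ← hc, casU]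
      simp only [map_add, map_sub, map_mul, map_smul]
      abel) hz
  let A : Subalgebra ℂ U :=
    { carrier := {w | ∀ z ∈ wordSpan (Θ eU) (Θ hU) (Θ fU),
        Θ w * z ∈ wordSpan (Θ eU) (Θ hU) (Θ fU)}
      mul_mem' := fun {a b} ha hb z hz => by
        rw [map_mul, mul_assoc]
        exact ha _ (hb z hz)
      add_mem' := fun {a b} ha hb z hz => by
        rw [map_add, add_mul]
        exact add_mem (ha z hz) (hb z hz)
      algebraMap_mem' := fun c z hz => by
        rw [AlgHom.commutes, ← Algebra.smul_def]
        exact Submodule.smul_mem _ c hz }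
  have hA := U_induction A (fun x z hz => by
    rw [eq_combination x]
    simp only [map_add, map_smul, add_mul, smul_mul_assoc]
    exact add_mem (add_mem (Submodule.smul_mem _ _ (key hz).1)
      (Submodule.smul_mem _ _ (key hz).2.1)) (Submodule.smul_mem _ _ (key hz).2.2)) w 1
      (by simpa using word_mem (Θ eU) (Θ hU) (Θ fU) 0 0)
  rwa [mul_one] at hA

/-! ### Linear independence -/

/-- The exponent of the leading monomial of `word d`. -/
def expo (d : ℕ × Fin 2 × ℕ) : Fin 2 →₀ ℕ :=
  Finsupp.single 0 (2 * d.2.2 + d.2.1) + Finsupp.single 1 (2 * d.1 + d.2.1)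

/-- The length of `word d`. -/
def len (d : ℕ × Fin 2 × ℕ) : ℕ := d.1 + d.2.1 + d.2.2

theorem expo_zero (d : ℕ × Fin 2 × ℕ) : expo d 0 = 2 * d.2.2 + d.2.1 := by simp [expo]

theorem expo_one (d : ℕ × Fin 2 × ℕ) : expo d 1 = 2 * d.1 + d.2.1 := by simp [expo]

theorem degree_expo (d : ℕ × Fin 2 × ℕ) : (expo d).degree = 2 * len d := by
  rw [degree_fin_two, expo_zero, expo_one, len]
  ring

/-- The exponents are `2j + n` and `2i + n` with `n ≤ 1`, so their parity gives `n`, and then `i`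
and `j` follow. This fails if higher powers of `h` are allowed. -/
theorem expo_injective : Function.Injective expo := by
  intro d d' hd
  have h0 := DFunLike.congr_fun hd 0
  have h1 := DFunLike.congr_fun hd 1
  rw [expo_zero, expo_zero] at h0
  rw [expo_one, expo_one] at h1
  have := d.2.1.isLt
  have := d'.2.1.isLt
  ext <;> omega

theorem psi_word {s : StarProduct} (hs : s.IsEquivariant) (d : ℕ × Fin 2 × ℕ) :
    ∃ a : ℂ, a ≠ 0 ∧ ∀ m : Fin 2 →₀ ℕ, 2 * len d ≤ m.degree →
      (rho (StarProduct.psi hs (word d))).coeff m = (MvPolynomial.monomial (expo d) a).coeff m := by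
  have h1 := (psi_prod_sub_mem hs
    (List.replicate d.1 e ++ List.replicate d.2.1 h ++ List.replicate d.2.2 f)).1
  simp only [List.map_append, List.map_replicate, List.prod_append, List.prod_replicate,
    List.length_append, List.length_replicate] at h1
  change StarProduct.psi hs (word d) - _ ∈ lowerFil (2 * len d) at h1
  -- The scalar collects the constants in `quad e = -v²` and `quad h = -2uv`.
  refine ⟨(-1) ^ d.1 * (-2) ^ (d.2.1 : ℕ), by simp, fun m hm => ?_⟩
  have h2 := h1 m hm
  rw [map_sub, MvPolynomial.coeff_sub, sub_eq_zero] at h2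
  rw [h2]
  congr 1
  rw [monomial_eq_u_v, expo_zero, expo_one]
  simp only [map_mul, map_pow, rho_mom, quad_e, quad_h, quad_f, map_neg, map_one, map_ofNat]
  rw [neg_pow (v ^ 2), neg_pow (2 * u * v), neg_pow (2 : P)]
  ring

theorem linearIndependent_psi_word {s : StarProduct} (hs : s.IsEquivariant) :
    LinearIndependent ℂ fun d => StarProduct.psi hs (word d) := by
  rw [linearIndependent_iff]
  intro l hl
  by_contra h0
  -- At the leading monomial of a longest word in the relation, the other words have coefficient
  -- zero.
  obtain ⟨d, hd, hmax⟩ := Finset.exists_max_image l.support len (Finsupp.support_nonempty_iff.2 h0)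
  have h1 := congrArg (fun r => (rho r).coeff (expo d)) hl
  simp only [Finsupp.linearCombination_apply, Finsupp.sum, map_sum, MvPolynomial.coeff_sum, map_smul,
    MvPolynomial.coeff_smul, map_zero, MvPolynomial.coeff_zero] at h1
  rw [Finset.sum_eq_single d] at h1
  · obtain ⟨a, ha, h2⟩ := psi_word hs d
    rw [h2 _ (degree_expo d).ge, MvPolynomial.coeff_monomial, if_pos rfl, smul_eq_mul] at h1
    exact (mul_ne_zero (Finsupp.mem_support_iff.1 hd) ha) h1
  · intro d' hd' hne
    obtain ⟨a, ha, h2⟩ := psi_word hs d'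
    rw [h2 _ (by rw [degree_expo]; exact Nat.mul_le_mul_left 2 (hmax d' hd')),
      MvPolynomial.coeff_monomial, if_neg (fun h => hne (expo_injective h)), smul_zero]
  · exact fun h => absurd hd h

/-! ### Kernels -/

theorem psi_casU {s : StarProduct} (hs : s.IsEquivariant) :
    StarProduct.psi hs casU = casimir s := by
  simp only [casU, map_add, map_sub, map_smul, StarProduct.psi_mul, hU, eU, fU, StarProduct.psi_ι,
    casimir]

theorem leftRep_casU {s : StarProduct} (hs : s.IsEquivariant) {c : ℂ}
    (hc : casimir s = algebraMap ℂ R c) :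
    StarProduct.leftRep hs casU = algebraMap ℂ (Module.End ℂ R) c := by
  rw [StarProduct.leftRep_eq, psi_casU, hc]
  ext r
  rw [Algebra.algebraMap_eq_smul_one, map_smul, LinearMap.smul_apply, StarProduct.circL_apply,
    s.one_circ, Module.algebraMap_end_apply]

/-- The kernel of `psi` is generated by the Casimir element up to its value. -/
theorem map_eq_zero_of_psi_eq_zero {s : StarProduct} (hs : s.IsEquivariant) {c : ℂ}
    (hc : casimir s = algebraMap ℂ R c) {Q : Type*} [Ring Q] [Algebra ℂ Q] (φ : U →ₐ[ℂ] Q)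
    (hφ : φ casU = algebraMap ℂ Q c) {w : U} (hw : StarProduct.psi hs w = 0) : φ w = 0 := by
  -- Using the product of the two homomorphisms yields one expansion of `w` into words valid for
  -- both. Independence in the second factor kills its coefficients, hence the first component too.
  have h1 := map_mem_span_word (φ.prod (StarProduct.leftRep hs)) (c := c)
    (by rw [AlgHom.prod_apply, hφ, leftRep_casU hs hc]; rfl) w
  obtain ⟨l, hl⟩ := (Finsupp.mem_span_range_iff_exists_finsupp).1 h1
  have h2 : l = 0 := by
    refine linearIndependent_iff.1 (linearIndependent_psi_word hs) l ?_
    have h3 := congrArg (fun q => q.2 1) hl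
    simp only [AlgHom.prod_apply] at h3
    rw [← StarProduct.psi_apply, hw] at h3
    rw [← h3, Finsupp.linearCombination_apply, Finsupp.sum, Finsupp.sum, Prod.snd_sum,
      LinearMap.sum_apply]
    rfl
  rw [h2, Finsupp.sum_zero_index] at hl
  exact (congrArg Prod.fst hl).symm

/-! ### Uniqueness -/

theorem coeff_X_mul_pderiv (i : Fin 2) (F : P) (m : Fin 2 →₀ ℕ) :
    ((MvPolynomial.X i : P) * MvPolynomial.pderiv i F).coeff m = m i * F.coeff m := by
  induction F using MvPolynomial.induction_on' with
  | monomial m' c =>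
    rw [MvPolynomial.X_mul_pderiv_monomial, nsmul_eq_mul, ← map_natCast MvPolynomial.C,
      MvPolynomial.coeff_C_mul, MvPolynomial.coeff_monomial]
    split_ifs with h
    · rw [h]
    · simp
  | add F G hF hG => rw [map_add, mul_add, MvPolynomial.coeff_add, hF, hG, MvPolynomial.coeff_add,
      mul_add]

theorem coeff_ham_quad_h (F : P) (m : Fin 2 →₀ ℕ) :
    (ham (quad h) F).coeff m = ((m 1 : ℂ) - m 0) * F.coeff m := by
  have : ham (quad h) F = v * dv F - u * du F := by
    rw [ham_quad]
    simp [h]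
  rw [this, MvPolynomial.coeff_sub, coeff_X_mul_pderiv, coeff_X_mul_pderiv, sub_mul]

namespace StarProduct

/-- The difference has degree less than `2k` in the plane but weight `2k` under `h`. The weight `m 1
- m 0` of a monomial is at most its degree, so the difference is zero. -/
theorem psi_eU_pow {s : StarProduct} (hs : s.IsEquivariant) (k : ℕ) :
    psi hs (eU ^ k) = mom e ^ k := by
  have h1 := (psi_prod_sub_mem hs (List.replicate k e)).1
  simp only [List.map_replicate, List.prod_replicate, List.length_replicate] at h1
  change psi hs (eU ^ k) - _ ∈ _ at h1
  have h2 : hamR h (psi hs (eU ^ k)) = (2 * k : ℂ) • psi hs (eU ^ k) := by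
    rw [← psi_lie, ← map_smul]
    congr 1
    change hU * eU ^ k - eU ^ k * hU = _
    rw [mul_pow_of_weight hU_mul_eU, add_sub_cancel_left]
  have h3 : hamR h (mom e ^ k) = (2 * k : ℂ) • mom e ^ k := by
    apply rho_injective
    ext m
    rw [rho_hamR, coeff_ham_quad_h, map_smul, MvPolynomial.coeff_smul, smul_eq_mul]
    have : rho (mom e ^ k) = MvPolynomial.monomial (Finsupp.single 1 (2 * k)) ((-1) ^ k) := by
      rw [map_pow, rho_mom, quad_e, monomial_eq_u_v, neg_pow]
      simp [pow_mul]
    rw [this, MvPolynomial.coeff_monomial]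
    split_ifs with hm
    · rw [← hm]
      simp
    · simp
  have h4 : hamR h (psi hs (eU ^ k) - mom e ^ k) =
      (2 * k : ℂ) • (psi hs (eU ^ k) - mom e ^ k) := by
    rw [map_sub, h2, h3, smul_sub]
  refine sub_eq_zero.1 (rho_injective ?_)
  rw [map_zero]
  ext m
  rw [MvPolynomial.coeff_zero]
  rcases Nat.lt_or_ge m.degree (2 * k) with hm | hm
  · have h5 := congrArg (fun r => (rho r).coeff m) h4
    simp only [rho_hamR, coeff_ham_quad_h, map_smul, MvPolynomial.coeff_smul, smul_eq_mul] at h5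
    rw [← sub_eq_zero, ← sub_mul] at h5
    refine (mul_eq_zero.1 h5).resolve_left fun h6 => ?_
    rw [degree_fin_two] at hm
    have h7 : ((m 1 : ℕ) : ℂ) = ((2 * k + m 0 : ℕ) : ℂ) := by
      push_cast
      linear_combination h6
    have := Nat.cast_injective h7
    omega
  · exact h1 m hm

theorem psi_surjective {s : StarProduct} (hs : s.IsEquivariant) :
    Function.Surjective (psi hs) := by
  refine eq_top_of_lowering (LinearMap.range (psi hs)) (fun k => ⟨_, psi_eU_pow hs k⟩) ?_
  rintro _ ⟨w, rfl⟩ r' hr'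
  refine ⟨_, (psi_lie hs f w).trans (rho_injective ?_)⟩
  rw [hr', rho_hamR]

theorem psi_eq_zero_of_casimir_eq {s s' : StarProduct} (hs : s.IsEquivariant)
    (hs' : s'.IsEquivariant) {c : ℂ} (hc : casimir s = algebraMap ℂ R c)
    (hc' : casimir s' = algebraMap ℂ R c) {w : U} (hw : psi hs w = 0) : psi hs' w = 0 := by
  rw [psi_apply, map_eq_zero_of_psi_eq_zero hs hc (leftRep hs') (leftRep_casU hs' hc') hw,
    LinearMap.zero_apply]

/-- The two maps agree on the powers of `e` and remain equal under commutators with `f`, so they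
agree on elements whose images fill `R`. Any `w` differs from such an element by something in the
common kernel. -/
theorem psi_eq_of_casimir_eq {s s' : StarProduct} (hs : s.IsEquivariant)
    (hs' : s'.IsEquivariant) {c : ℂ} (hc : casimir s = algebraMap ℂ R c)
    (hc' : casimir s' = algebraMap ℂ R c) (w : U) : psi hs w = psi hs' w := by
  have key : psi hs w ∈ (LinearMap.eqLocus (psi hs) (psi hs')).map (psi hs) := by
    refine eq_top_of_lowering ((LinearMap.eqLocus (psi hs) (psi hs')).map (psi hs))
      (fun k => ?_) ?_ _
    · exact ⟨eU ^ k, (psi_eU_pow hs k).trans (psi_eU_pow hs' k).symm, psi_eU_pow hs k⟩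
    · rintro _ ⟨w, hw, rfl⟩ r' hr'
      refine ⟨_, ?_, (psi_lie hs f w).trans (rho_injective ?_)⟩
      · change psi hs _ = psi hs' _
        rw [psi_lie, psi_lie, show psi hs w = psi hs' w from hw]
      · rw [hr', rho_hamR]
  obtain ⟨w', hw', h1⟩ := key
  have h2 : psi hs (w - w') = 0 := by rw [map_sub, h1, sub_self]
  have h3 := psi_eq_zero_of_casimir_eq hs hs' hc hc' h2
  rw [map_sub, sub_eq_zero] at h3
  rw [h3, ← h1]
  exact hw'

end StarProduct

/-- Distinct powers of `t` have coefficients in distinct degrees of `R`, so nothing cancels at `t =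
1`. Thus `⋆` can be recovered from `∘`. -/
theorem eq_zero_of_mem_totalGr_of_eval {n : ℤ} {F : R[X]} (hF : F ∈ totalGr n)
    (h1 : F.eval 1 = 0) : F = 0 := by
  have hdeg (p : ℕ) (m : Fin 2 →₀ ℕ) (hm : (m.degree : ℤ) ≠ 2 * (n - p)) :
      (rho (F.coeff p)).coeff m = 0 := by
    have hp := hF p
    rcases lt_or_ge (n - p) 0 with h0 | h0
    · rw [Rgr_of_neg h0, Submodule.mem_bot] at hp
      rw [hp, map_zero, MvPolynomial.coeff_zero]
    · obtain ⟨k, hk⟩ := Int.eq_ofNat_of_zero_le h0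
      rw [hk] at hp hm
      exact ((mem_Rgr_iff k _).1 hp).coeff_eq_zero (by omega)
  ext p
  apply rho_injective
  rw [Polynomial.coeff_zero, map_zero]
  ext m
  rw [MvPolynomial.coeff_zero]
  by_cases hm : (m.degree : ℤ) = 2 * (n - p)
  · by_cases hp : p ∈ Finset.range (F.natDegree + 1)
    · rw [Polynomial.eval_eq_sum_range] at h1
      have h2 := congrArg (fun r => (rho r).coeff m) h1
      simp only [one_pow, mul_one, map_sum, MvPolynomial.coeff_sum, map_zero,
        MvPolynomial.coeff_zero] at h2
      rwa [Finset.sum_eq_single_of_mem p hp (fun q _ hq => hdeg q m (by omega))] at h2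
    · rw [Polynomial.coeff_eq_zero_of_natDegree_lt (by simpa using hp), map_zero,
        MvPolynomial.coeff_zero]
  · exact hdeg p m hm

theorem StarProduct.ext_circ {s s' : StarProduct} (hc : ∀ r r', s.circ r r' = s'.circ r r') :
    s = s' := by
  have hhom (k l : ℕ) (r : R) (hr : r ∈ Rgr k) (r' : R) (hr' : r' ∈ Rgr l) :
      s.star (Polynomial.C r) (Polynomial.C r') = s'.star (Polynomial.C r) (Polynomial.C r') := by
    refine sub_eq_zero.1 (eq_zero_of_mem_totalGr_of_eval (n := (k : ℤ) + l) (sub_mem ?_ ?_) ?_)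
    · exact fun p => s.graded p k l r hr r' hr'
    · exact fun p => s'.graded p k l r hr r' hr'
    · rw [Polynomial.eval_sub]
      exact sub_eq_zero.2 (hc r r')
  have hC (r r' : R) :
      s.star (Polynomial.C r) (Polynomial.C r') = s'.star (Polynomial.C r) (Polynomial.C r') := by
    let ι₀ : R →ₗ[ℂ] R[X] := (Polynomial.monomial 0).restrictScalars ℂ
    refine eq_top_of_Rgr_le (LinearMap.eqLocus (s.star (Polynomial.C r) ∘ₗ ι₀)
      (s'.star (Polynomial.C r) ∘ₗ ι₀)) (fun l r' hr' => ?_) r'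
    refine eq_top_of_Rgr_le (LinearMap.eqLocus (s.star.flip (Polynomial.C r') ∘ₗ ι₀)
      (s'.star.flip (Polynomial.C r') ∘ₗ ι₀)) (fun k r hr => ?_) r
    exact hhom k l r hr r' hr'
  apply StarProduct.ext
  ext F G : 2
  induction F using Polynomial.induction_on' with
  | add F F' hF hF' => simp only [map_add, LinearMap.add_apply, hF, hF']
  | monomial n r =>
    induction n with
    | succ n ih => rw [← Polynomial.X_mul_monomial, s.X_star, s'.X_star, ih]
    | zero =>
      induction G using Polynomial.induction_on' with
      | add G G' hG hG' => simp only [map_add, hG, hG']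
      | monomial n r' =>
        induction n with
        | succ n ih => rw [← Polynomial.X_mul_monomial, s.star_X, s'.star_X, ih]
        | zero => exact hC r r'

/-- An equivariant star product is determined by the value of the Casimir element. -/
theorem StarProduct.eq_of_casimir_eq {s s' : StarProduct} (hs : s.IsEquivariant)
    (hs' : s'.IsEquivariant) {c : ℂ} (hc : casimir s = algebraMap ℂ R c)
    (hc' : casimir s' = algebraMap ℂ R c) : s = s' := by
  apply StarProduct.ext_circ
  intro r r'
  obtain ⟨w, rfl⟩ := psi_surjective hs r
  obtain ⟨w', rfl⟩ := psi_surjective hs r'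
  rw [← psi_mul, psi_eq_of_casimir_eq hs hs' hc hc' (w * w'),
    psi_eq_of_casimir_eq hs hs' hc hc' w, psi_eq_of_casimir_eq hs hs' hc hc' w', ← psi_mul]

/-- Only `t⁰`, `t¹` and `t²` occur, by degree. Parity makes `C_1` antisymmetric, hence half the
bracket, and `C_2` has degree zero. -/
theorem circ_mom_mom (s : StarProduct) (x y : g) : ∃ c : ℂ, s.circ (mom x) (mom y) =
    mom x * mom y + (1 / 2 : ℂ) • mom ⁅x, y⁆ + algebraMap ℂ R c := by
  set F := s.star (Polynomial.C (mom x)) (Polynomial.C (mom y)) with hF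
  have hgr (p : ℕ) : F.coeff p ∈ Rgr (2 - p) := by
    have := s.graded p 1 1 _ (mom_mem_Rgr x) _ (mom_mem_Rgr y)
    rwa [show ((1 : ℕ) : ℤ) + ((1 : ℕ) : ℤ) - p = 2 - p by norm_num] at this
  have h2 := hgr 2
  rw [show (2 : ℤ) - ((2 : ℕ) : ℤ) = (0 : ℕ) by norm_num, Rgr_natCast, pow_zero,
    Submodule.mem_one] at h2
  obtain ⟨c, hc⟩ := h2
  have h1 : F.coeff 1 = (1 / 2 : ℂ) • mom ⁅x, y⁆ := by
    have e1 := s.coeff_one (SymmetricAlgebra.ι ℂ g x) (SymmetricAlgebra.ι ℂ g y)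
    rw [← hamR_proj] at e1
    change F.coeff 1 - _ = hamR x (mom y) at e1
    change F.coeff 1 - (s.star (Polynomial.C (mom y)) (Polynomial.C (mom x))).coeff 1 = _ at e1
    rw [s.parity 1 (mom y) (mom x), hamR_mom, pow_one, neg_one_mul, sub_neg_eq_add, ← hF,
      ← two_smul ℂ] at e1
    rw [← e1, smul_smul]
    norm_num
  refine ⟨c, ?_⟩
  have hdeg : F.natDegree < 3 := by
    rw [Nat.lt_succ_iff, Polynomial.natDegree_le_iff_coeff_eq_zero]
    intro p hp
    have := hgr p
    rwa [Rgr_of_neg (by omega), Submodule.mem_bot] at this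
  change F.eval 1 = _
  rw [Polynomial.eval_eq_sum_range' hdeg]
  simp only [Finset.sum_range_succ, Finset.sum_range_zero, one_pow, mul_one, zero_add, h1, ← hc]
  rw [hF, s.coeff_zero]

theorem mom_h_mul_mom_h : mom h * mom h + (4 : ℂ) • (mom e * mom f) = 0 := by
  apply rho_injective
  have : (MvPolynomial.C 4 : P) = 4 := map_ofNat _ 4
  simp only [map_add, map_smul, map_mul, rho_mom, quad_e, quad_f, quad_h, map_zero,
    MvPolynomial.smul_eq_C_mul, this]
  ring

theorem exists_casimir_eq (s : StarProduct) : ∃ c : ℂ, casimir s = algebraMap ℂ R c := by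
  obtain ⟨c, hc⟩ := circ_mom_mom s h h
  obtain ⟨c', hc'⟩ := circ_mom_mom s e f
  refine ⟨c + 4 * c', ?_⟩
  have h0 := mom_h_mul_mom_h
  rw [casimir, hc, hc', lie_self, lie_e_f]
  simp only [map_add, map_mul, Algebra.smul_def, map_zero] at *
  have : algebraMap ℂ R 4 * algebraMap ℂ R (1 / 2) = algebraMap ℂ R 2 := by
    rw [← map_mul]
    norm_num
  linear_combination h0 + mom h * this

/-! ### Twisted differential operators -/

theorem Phi_ι (l : ℂ) (x : g) :
    ((Phi l (UniversalEnvelopingAlgebra.ι ℂ x) : twistedDiffOp l) : Op) = twistedVF l x :=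
  congrArg Subtype.val (UniversalEnvelopingAlgebra.lift_ι_apply ℂ (phiLie l) x)

theorem entry_eq (i j : Fin 2) (x : g) : (x : Matrix (Fin 2) (Fin 2) ℂ) i j = entry i j x := rfl

theorem ddz_T_one : ddz (LaurentPolynomial.T 1) = 1 := by
  rw [ddz_T]
  simp

theorem twistedVF_e (l : ℂ) (F : ℂ[T;T⁻¹]) : twistedVF l e F = -ddz F := by
  rw [twistedVF, ddz_vf]
  simp [vf, entry_eq, e_eq]

theorem twistedVF_h (l : ℂ) (F : ℂ[T;T⁻¹]) : twistedVF l h F =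
    -(2 * LaurentPolynomial.T 1 * ddz F) - 2 * LaurentPolynomial.C l * F := by
  rw [twistedVF, ddz_vf]
  simp [vf, entry_eq, h, C_two, LaurentPolynomial.smul_eq_C_mul]
  ring

theorem twistedVF_f (l : ℂ) (F : ℂ[T;T⁻¹]) : twistedVF l f F =
    LaurentPolynomial.T 1 * LaurentPolynomial.T 1 * ddz F +
      2 * LaurentPolynomial.C l * LaurentPolynomial.T 1 * F := by
  rw [twistedVF, ddz_vf]
  have hT : (LaurentPolynomial.T 2 : ℂ[T;T⁻¹]) =
      LaurentPolynomial.T 1 * LaurentPolynomial.T 1 := by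
    rw [← LaurentPolynomial.T_add]; norm_num
  simp [vf, entry_eq, f, C_two, hT, LaurentPolynomial.smul_eq_C_mul]
  ring

theorem Phi_casU (l : ℂ) : Phi l casU = algebraMap ℂ _ (4 * l * (l - 1)) := by
  apply Subtype.ext
  change (twistedDiffOp l).val (Phi l casU) = (twistedDiffOp l).val (algebraMap ℂ _ _)
  rw [AlgHom.commutes, casU]
  simp only [map_add, map_sub, map_smul, map_mul]
  change ((Phi l hU : twistedDiffOp l) : Op) * (Phi l hU : twistedDiffOp l) - _ •
    ((Phi l hU : twistedDiffOp l) : Op) + _ • (((Phi l eU : twistedDiffOp l) : Op) *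
    (Phi l fU : twistedDiffOp l)) = _
  rw [eU, hU, fU, Phi_ι, Phi_ι, Phi_ι]
  have hC (c : ℂ) : ddz (LaurentPolynomial.C c) = 0 := ddz.map_algebraMap c
  have h2 : ddz 2 = 0 := by rw [← C_two, hC]
  have h4 : (LaurentPolynomial.C 4 : ℂ[T;T⁻¹]) = 4 := map_ofNat _ 4
  apply LinearMap.ext
  intro F
  rw [← map_mul, ← map_sub, ← map_mul, Module.algebraMap_end_apply]
  simp only [LinearMap.add_apply, LinearMap.sub_apply, LinearMap.smul_apply, Module.End.mul_apply,
    twistedVF_e, twistedVF_h, twistedVF_f, LaurentPolynomial.smul_eq_C_mul, map_add, map_sub,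
    map_neg, Derivation.leibniz, ddz_T_one, hC, h2, smul_eq_mul, map_mul, C_two, h4, map_one]
  ring

/-- Since `e` acts by `-d/dz`, its powers take `1/z` to nonzero multiples of distinct powers of `z`;
`1/z` serves as test vector for their independence. -/
theorem Phi_eU_pow_T (l : ℂ) (k : ℕ) :
    ((Phi l (eU ^ k) : twistedDiffOp l) : Op) (LaurentPolynomial.T (-1)) =
      (k.factorial : ℂ) • LaurentPolynomial.T (-1 - k) := by
  induction k with
  | zero => simp
  | succ k ih =>
    rw [pow_succ', map_mul]
    change ((Phi l eU : twistedDiffOp l) : Op) (((Phi l (eU ^ k) : twistedDiffOp l) : Op) _) = _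
    rw [ih, eU, Phi_ι, twistedVF_e, Derivation.map_smul, ddz_T, ← LaurentPolynomial.smul_eq_C_mul,
      smul_smul, ← neg_smul, Nat.factorial_succ,
      show (-1 - (k : ℤ)) - 1 = -1 - ((k + 1 : ℕ) : ℤ) by push_cast; ring]
    congr 1
    push_cast
    ring

theorem eq_zero_of_Phi_eq_zero (l : ℂ) (a : ℕ →₀ ℂ)
    (ha : Phi l (a.sum fun k c => c • eU ^ k) = 0) : a = 0 := by
  have h1 := congrArg (fun D : twistedDiffOp l => (D : Op) (LaurentPolynomial.T (-1))) ha
  have h2 : (((Phi l (a.sum fun k c => c • eU ^ k)) : twistedDiffOp l) : Op)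
      (LaurentPolynomial.T (-1)) =
      ∑ k ∈ a.support, (a k * k.factorial) • LaurentPolynomial.T (-1 - (k : ℤ)) := by
    rw [Finsupp.sum, map_sum, AddSubmonoidClass.coe_finsetSum, LinearMap.sum_apply]
    refine Finset.sum_congr rfl fun k _ => ?_
    rw [map_smul, SetLike.val_smul, LinearMap.smul_apply, Phi_eU_pow_T, smul_smul]
  simp only [h2] at h1
  ext k
  by_contra hk
  have h3 := congrArg (fun F => AddMonoidAlgebra.coeffLinearEquiv ℂ F (-1 - (k : ℤ))) h1
  simp only [map_sum, map_smul, Finsupp.finsetSum_apply, Finsupp.smul_apply] at h3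
  have hT (n m : ℤ) : AddMonoidAlgebra.coeffLinearEquiv ℂ (LaurentPolynomial.T n : ℂ[T;T⁻¹]) m =
      if n = m then 1 else 0 := Finsupp.single_apply
  rw [Finset.sum_eq_single_of_mem k (Finsupp.mem_support_iff.2 hk)] at h3
  · rw [hT, if_pos rfl] at h3
    simp only [smul_eq_mul, mul_one, ZeroMemClass.coe_zero, LinearMap.zero_apply, map_zero,
      Finsupp.coe_zero, Pi.zero_apply] at h3
    exact mul_ne_zero hk (Nat.cast_ne_zero.2 k.factorial_ne_zero) h3
  · intro k' _ hne
    rw [hT, if_neg (by omega), smul_zero]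

/-- The operator is `-v ∂_u`, which lowers the exponent of `u`. Phrasing nilpotency by the
generalized eigenspace makes the condition a submodule, so monomials suffice. -/
theorem exists_hamR_e_pow_eq_zero (r : R) : ∃ n : ℕ, ((hamR e) ^ n) r = 0 := by
  have hM (r : R) : r ∈ Module.End.maxGenEigenspace (hamR e) 0 ↔ ∃ n : ℕ, ((hamR e) ^ n) r = 0 := by
    rw [Module.End.mem_maxGenEigenspace, zero_smul, sub_zero]
  have hstep (r : R) (hr : hamR e r ∈ Module.End.maxGenEigenspace (hamR e) 0) :
      r ∈ Module.End.maxGenEigenspace (hamR e) 0 := by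
    rw [hM] at *
    obtain ⟨n, hn⟩ := hr
    exact ⟨n + 1, by rwa [pow_succ, Module.End.mul_apply]⟩
  have key : ∀ i j : ℕ, ∀ r, rho r = u ^ i * v ^ j → r ∈ Module.End.maxGenEigenspace (hamR e) 0 := by
    intro i
    induction i with
    | zero =>
      intro j r hr
      apply hstep
      have : hamR e r = 0 := by
        apply rho_injective
        rw [rho_hamR, hr, ham_quad]
        simp [e_eq, Derivation.leibniz_pow]
      rw [this]
      exact zero_mem _
    | succ i ih =>
      intro j r hr
      apply hstep
      have hi : (-((i : ℂ) + 1)) ≠ 0 := neg_ne_zero.2 (Nat.cast_add_one_ne_zero i)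
      have h1 := ih (j + 1) ((-((i : ℂ) + 1))⁻¹ • hamR e r) (by
        rw [map_smul, inv_smul_eq_iff₀ hi, rho_hamR, hr, ham_quad, MvPolynomial.smul_eq_C_mul]
        simp [e_eq, Derivation.leibniz, Derivation.leibniz_pow]
        ring)
      have h2 := Submodule.smul_mem _ (-((i : ℂ) + 1)) h1
      rwa [smul_inv_smul₀ hi] at h2
  rw [← hM]
  refine mem_of_monomials _ r fun m _ r' hr' => key (m 0) (m 1) r' ?_
  rw [hr', monomial_eq_u_v, map_one, one_mul]

/-- An invariant of `-v ∂_u` does not involve `u`, and the even powers of `v` are the powers of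
`μ_e` up to sign. -/
theorem mem_span_of_hamR_e_eq_zero {r : R} (hr : hamR e r = 0) :
    r ∈ Submodule.span ℂ (Set.range fun k : ℕ => mom e ^ k) := by
  have h1 : du (rho r) = 0 := by
    have := congrArg rho hr
    rw [rho_hamR, ham_quad, map_zero] at this
    simpa [e_eq] using this
  refine mem_of_monomials _ r fun m hm r' hr' => ?_
  obtain ⟨k, hk⟩ := even_iff_two_dvd.1 (even_degree_of_mem_support hm)
  have h2 := coeff_X_mul_pderiv 0 (rho r) m
  rw [h1, mul_zero, MvPolynomial.coeff_zero] at h2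
  have h3 : m 0 = 0 := by
    have := (mul_eq_zero.1 h2.symm).resolve_right (MvPolynomial.mem_support_iff.1 hm)
    exact_mod_cast this
  rw [degree_fin_two, h3, zero_add] at hk
  have : r' = (-1 : ℂ) ^ k • mom e ^ k := by
    apply rho_injective
    rw [hr', monomial_eq_u_v, h3, hk, map_smul, map_pow, rho_mom, quad_e,
      MvPolynomial.smul_eq_C_mul, map_pow, map_neg, map_one, ← mul_pow, pow_mul]
    ring
  rw [this]
  exact Submodule.smul_mem _ _ (Submodule.subset_span ⟨k, rfl⟩)

theorem Phi_eq_zero_of_psi_eq_zero {s : StarProduct} (hs : s.IsEquivariant) {l : ℂ}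
    (hc : casimir s = algebraMap ℂ R (4 * l * (l - 1))) {w : U}
    (hw : StarProduct.psi hs w = 0) : Phi l w = 0 := by
  apply Subtype.ext
  refine map_eq_zero_of_psi_eq_zero hs hc ((twistedDiffOp l).val.comp (Phi l)) ?_ hw
  rw [AlgHom.comp_apply, Phi_casU, AlgHom.commutes]

/-- Induction on the order of nilpotency of `hamR e` at `psi w`. The commutator of `e` with `w`
stays in the kernel of `Phi l` and has smaller order, so `psi w` is invariant under `e` and comes
from a polynomial in `e`. The inclusion of kernels already known puts that polynomial in the kernel
of `Phi l`, where only zero is possible. -/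
theorem psi_eq_zero_of_Phi_eq_zero {s : StarProduct} (hs : s.IsEquivariant) {l : ℂ}
    (hc : casimir s = algebraMap ℂ R (4 * l * (l - 1))) {w : U} (hw : Phi l w = 0) :
    StarProduct.psi hs w = 0 := by
  obtain ⟨n, hn⟩ := exists_hamR_e_pow_eq_zero (StarProduct.psi hs w)
  induction n generalizing w with
  | zero => exact hn
  | succ n ih =>
    have h1 : hamR e (StarProduct.psi hs w) = 0 := by
      rw [← StarProduct.psi_lie]
      apply ih
      · rw [map_sub, map_mul, map_mul, hw, mul_zero, zero_mul]
        exact sub_self 0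
      · rwa [StarProduct.psi_lie, ← Module.End.mul_apply, ← pow_succ]
    obtain ⟨a, ha⟩ :=
      Finsupp.mem_span_range_iff_exists_finsupp.1 (mem_span_of_hamR_e_eq_zero h1)
    have h2 : StarProduct.psi hs (w - a.sum fun k c => c • eU ^ k) = 0 := by
      rw [map_sub, ← ha, Finsupp.sum, Finsupp.sum, map_sum, sub_eq_zero]
      refine Finset.sum_congr rfl fun k _ => ?_
      rw [map_smul, StarProduct.psi_eU_pow]
    have h3 := Phi_eq_zero_of_psi_eq_zero hs hc h2
    rw [map_sub, hw] at h3
    rw [← ha, eq_zero_of_Phi_eq_zero l a (sub_eq_zero.1 h3).symm, Finsupp.sum_zero_index]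

theorem correspondsTo_iff {s : StarProduct} (hs : s.IsEquivariant) (l : ℂ) :
    s.CorrespondsTo (J l) ↔ casimir s = algebraMap ℂ R (4 * l * (l - 1)) := by
  constructor
  · rintro ⟨Ψ, h1, hm, hι, hJ⟩
    have h2 : casU - algebraMap ℂ U (4 * l * (l - 1)) ∈ J l := by
      change Phi l _ = 0
      rw [map_sub, Phi_casU, AlgHom.commutes, sub_self]
    rw [hJ, StarProduct.psi_eq_of_hom hs h1 hm hι, map_sub, psi_casU,
      Algebra.algebraMap_eq_smul_one, map_smul, StarProduct.psi_one, sub_eq_zero,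
      ← Algebra.algebraMap_eq_smul_one] at h2
    exact h2
  · intro hc
    exact ⟨StarProduct.psi hs, StarProduct.psi_one hs, StarProduct.psi_mul hs, StarProduct.psi_ι hs,
      fun w => ⟨fun hw => psi_eq_zero_of_Phi_eq_zero hs hc hw,
        fun hw => Phi_eq_zero_of_psi_eq_zero hs hc hw⟩⟩

theorem algebraMap_R_injective : Function.Injective (algebraMap ℂ R) := by
  intro c c' hc
  have := congrArg rho hc
  rw [AlgHom.commutes, AlgHom.commutes, MvPolynomial.algebraMap_eq] at this
  exact MvPolynomial.C_injective _ _ this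

theorem casimir_starProduct_twist (l : ℂ) :
    casimir (starProduct (4 * (2 * l - 1) ^ 2)) = algebraMap ℂ R (4 * l * (l - 1)) := by
  rw [casimir_starProduct]
  congr 1
  ring

end SlTwo

end

/-! ### The classification -/

/-- There is a family `⋆_l` of `G`-equivariant graded star products on `R`, indexed by complex
numbers, such that `⋆_l` is the unique one corresponding to `J^l = Ker Φ^l`, such that every
`G`-equivariant graded star product on `R` is some `⋆_l`, and such that `⋆_l = ⋆_m` if and only if
`m = ±(l - 1/2) + 1/2`. -/
theorem corollary3p2 :
    ∃ starOf : ℂ → SlTwo.StarProduct,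
      (∀ l : ℂ, (starOf l).IsEquivariant) ∧
      (∀ (l : ℂ) (s : SlTwo.StarProduct), s.IsEquivariant →
        (s.CorrespondsTo (SlTwo.J l) ↔ s = starOf l)) ∧
      (∀ s : SlTwo.StarProduct, s.IsEquivariant → ∃ l : ℂ, s = starOf l) ∧
      (∀ l m : ℂ, starOf l = starOf m ↔ m = l ∨ m = 1 - l) := by
  -- The parameter is the solution `τ` of `τ/4 - 1 = 4l(l - 1)`.
  refine ⟨fun l => SlTwo.starProduct (4 * (2 * l - 1) ^ 2),
    fun l => SlTwo.starProduct_isEquivariant _, fun l s hs => ?_, fun s hs => ?_, fun l m => ?_⟩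
  · rw [SlTwo.correspondsTo_iff hs]
    constructor
    · exact fun hc => SlTwo.StarProduct.eq_of_casimir_eq hs (SlTwo.starProduct_isEquivariant _) hc
        (SlTwo.casimir_starProduct_twist l)
    · rintro rfl
      exact SlTwo.casimir_starProduct_twist l
  · obtain ⟨c, hc⟩ := SlTwo.exists_casimir_eq s
    -- Since `4l(l - 1) + 1 = (2l - 1)²`, a square root `z` of `c + 1` gives `l = (z + 1)/2`.
    obtain ⟨z, hz⟩ := IsAlgClosed.exists_pow_nat_eq (c + 1) (n := 2) (by norm_num)
    refine ⟨(z + 1) / 2, SlTwo.StarProduct.eq_of_casimir_eq hs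
      (SlTwo.starProduct_isEquivariant _) hc ?_⟩
    rw [SlTwo.casimir_starProduct_twist]
    congr 1
    linear_combination hz
  · constructor
    · intro hlm
      have h1 := congrArg SlTwo.casimir hlm
      rw [SlTwo.casimir_starProduct_twist, SlTwo.casimir_starProduct_twist] at h1
      have h2 := SlTwo.algebraMap_R_injective h1
      have h3 : (m - l) * (m - (1 - l)) = 0 := by linear_combination -h2 / 4
      rcases mul_eq_zero.1 h3 with h | h
      · exact Or.inl (sub_eq_zero.1 h)
      · exact Or.inr (sub_eq_zero.1 h)
    · rintro (rfl | rfl)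
      · rfl
      · change SlTwo.starProduct _ = SlTwo.starProduct _
        congr 1
        ring
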